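/- A tract is a commutative monoid with zero $F$ with $F^\times=F\setminus\{0\}$, together with a subset $N_F$ (nullset) of the group semiring $\mathbb N[F^\times]$ that contains $0$, does not contain $1$, is stable under multiplication by $F^\times$, and for which there is a unique $\epsilon\in F^\times$ with $1+\epsilon\in N_F$. A tract morphism $f:F\to F'$ is a multiplicative map with $f(0)=0$, $f(1)=1$ such that $\sum f(a_i)\in N_{F'}$ whenever $\sum a_i\in N_F$. Let $E$ be a finite totally ordered set with $n$ elements. For $\mu:E^r\to F$ and $\nu:E^w\to F$, the Plücker flag relations are $$\sum_{k=1}^{w+1}\epsilon^k\,\nu(y_1,\dots,\widehat{y_k},\dots,y_{w+1})\,\mu(y_k,x_1,\dots,x_{r-1})\in N_F$$ for all $x_1,\dots,x_{r-1},y_1,\dots,y_{w+1}\in E$ (no condition if $r=0$). An $F$-matroid of rank $r$ on $E$ is a class $M=[\varphi]=\{c\varphi\mid c\in F^\times\}$ of a Grassmann–Plücker function $\varphi:E^r\to F$, i.e. a function that is not identically zero, alternating (exchanging two entries multiplies it by $\epsilon$, and it vanishes if two entries agree) and such that $\mu=\nu=\varphi$ satisfy the Plücker flag relations. Its underlying matroid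 has as bases the sets $\{x_1,\dots,x_r\}$ with $\varphi(x_1,\dots,x_r)\ne0$. A flag $F$-matroid of rank $(r_1,\dots,r_s)$ on $E$ is a sequence $\mathbf M=(M_1,\dots,M_s)$ of $F$-matroids $M_i$ of rank $r_i$ on $E$ such that for all $i<j$ all representatives $\mu$ of $M_i$ and $\nu$ of $M_j$ satisfy the Plücker flag relations. Fix an involution $\tau:F\to F$ (a tract morphism with $\tau^2=\mathrm{id}$). For an $F$-matroid $M=[\varphi]$ of rank $r$ on $E$, the dual $M^*=[\varphi^*]$ is given by the alternating function $\varphi^*:E^{n-r}\to F$ with $\varphi^*(x_1,\dots,x_{n-r})=\mathrm{sign}(x_1,\dots,x_{n-r},x_1',\dots,x_r')\,\tau(\varphi(x_1',\dots,x_r'))$ whenever $E=\{x_1,\dots,x_{n-r},x'_1,\dots,x'_r\}$, where $-1$ is read as $\epsilon$. For $A\subseteq E$, the contraction $M/A$ and the deletion $M\setminus A$ are the classes of the functions $x\mapsto\varphi(x,a_1,\dots,a_l)$ on tuples in $E\setminus A$, where $\{a_1,\dots,a_l\}$ is, respectively, a maximal independent subset of $A$, or a subset of $A$ that is a basis of the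 contraction of the underlying matroid by $E\setminus A$. The push-forward along a tract morphism $f:F\to F'$ is $f_*M=[f\circ\varphi]$. Theorem. Let $\mathbf M=(M_1,\dots,M_s)$ be a flag $F$-matroid on $E$. Then: (1) the dual sequence $\mathbf M^*=(M_s^*,\dots,M_1^*)$ is a flag $F$-matroid on $E$; (2) for all disjoint $I,J\subseteq E$, the sequence $\mathbf M\setminus I/J=(M_1\setminus I/J,\dots,M_s\setminus I/J)$ is a flag $F$-matroid on $E\setminus(I\cup J)$, and $(\mathbf M\setminus I/J)^*=\mathbf M^*\setminus J/I$; (3) for all $1\le i_1\le\dots\le i_t\le s$, the sequence $(M_{i_1},\dots,M_{i_t})$ is a flag $F$-matroid on $E$; (4) for every tract morphism $f:F\to F'$, the sequence $f_*\mathbf M=(f_*M_1,\dots,f_*M_s)$ is a flag $F'$-matroid on $E$. Moreover, for all integers $0\le r_1\le\dots\le r_s\le n$, the map $\mathbf M\mapsto\mathbf M^*$ is a bijection from the set of flag $F$-matroids on $E$ of rank $(r_1,\dots,r_s)$ to the set of flag $F$-matroids on $E$ of rank $(n-r_s,\dots,n-r_1)$. -/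

import Mathlib

noncomputable section

/-- A tract: a commutative monoid with zero in which exactly the nonzero elements are invertible,
together with a nullset in the group semiring `ℕ[Fˣ]`. The field `eps` records the unique
unit `ε` with `1 + ε` in the nullset. -/
class Tract (F : Type*) extends CommGroupWithZero F where
  nullset : Set (MonoidAlgebra ℕ Fˣ)
  zero_mem : 0 ∈ nullset
  one_notMem : 1 ∉ nullset
  eps : Fˣ
  one_add_eps_mem : 1 + MonoidAlgebra.of ℕ Fˣ eps ∈ nullset
  eps_unique : ∀ u : Fˣ, 1 + MonoidAlgebra.of ℕ Fˣ u ∈ nullset → u = eps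
  smul_mem : ∀ (a : Fˣ) (x : MonoidAlgebra ℕ Fˣ), x ∈ nullset →
    MonoidAlgebra.of ℕ Fˣ a * x ∈ nullset

namespace Tract

open Classical in
/-- An element of `F`, viewed in `ℕ[Fˣ]`: a unit is sent to the corresponding basis element
and zero is sent to zero. -/
def toSemiring {F : Type*} [Tract F] (a : F) : MonoidAlgebra ℕ Fˣ :=
  if h : a = 0 then 0 else MonoidAlgebra.of ℕ Fˣ (Units.mk0 a h)

/-- The formal sum `∑ a_k`, an element of `ℕ[Fˣ]`, lies in the nullset of `F`. -/
def IsNull {F : Type*} [Tract F] {m : ℕ} (a : Fin m → F) : Prop :=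
  ∑ k, toSemiring (a k) ∈ Tract.nullset (F := F)

/-- The sign `1` or `-1` as an element of `F`, where `-1` is identified with `ε`. -/
def ofSign (F : Type*) [Tract F] (u : ℤˣ) : F :=
  if u = 1 then 1 else (Tract.eps (F := F) : F)

end Tract

/-- A morphism of tracts. -/
structure TractHom (F F' : Type*) [Tract F] [Tract F'] extends F →*₀ F' where
  map_null : ∀ {m : ℕ} (a : Fin m → F), Tract.IsNull a →
    Tract.IsNull (fun k => toMonoidWithZeroHom (a k))

/-- `τ` is an involution of the tract `F`. -/
def TractHom.IsInvolution {F : Type*} [Tract F] (τ : TractHom F F) : Prop :=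
  ∀ a : F, τ.toMonoidWithZeroHom (τ.toMonoidWithZeroHom a) = a

/-- The Plücker flag relations for a pair of functions `μ : E^r → F` and `ν : E^w → F`:
`∑_{k=1}^{w+1} ε^k ν(y_1, …, ŷ_k, …, y_{w+1}) μ(y_k, x_1, …, x_{r-1}) ∈ N_F`.
For `r = 0` there is no such relation. -/
def FlagRelations {F α : Type*} [Tract F] (E : Finset α) {r w : ℕ}
    (μ : (Fin r → α) → F) (ν : (Fin w → α) → F) : Prop :=
  ∀ (m : ℕ) (hm : r = m + 1) (x : Fin m → α) (y : Fin (w + 1) → α),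
    (∀ i, x i ∈ E) → (∀ i, y i ∈ E) →
    Tract.IsNull (fun k : Fin (w + 1) =>
      (Tract.eps (F := F) : F) ^ ((k : ℕ) + 1) * ν (fun i => y (k.succAbove i)) *
        μ (fun i => (Fin.cons (y k) x : Fin (m + 1) → α) (Fin.cast hm i)))

/-- `φ` is a Grassmann-Plücker function of rank `r` on the finite set `E` with coefficients in
`F`. Functions on `E^r` are represented by functions on all `r`-tuples of elements of the ambient
type `α` that vanish on the tuples with some entry outside of `E`. -/
structure IsGrassmannPlucker {F α : Type*} [Tract F] (E : Finset α) (r : ℕ)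
    (φ : (Fin r → α) → F) : Prop where
  support : ∀ x, (∃ i, x i ∉ E) → φ x = 0
  nonzero : ∃ x, φ x ≠ 0
  swap : ∀ (x : Fin r → α) (i j : Fin r), i ≠ j →
    φ x = (Tract.eps (F := F) : F) * φ (x ∘ Equiv.swap i j)
  eq_zero : ∀ (x : Fin r → α) (i j : Fin r), i ≠ j → x i = x j → φ x = 0
  plucker : FlagRelations E φ φ

/-- A finite ground set, a rank and a set of functions `E^r → F`. This is the raw data of an
`F`-matroid; see `FMatroidData.IsFMatroid` for the defining property. -/
@[ext]
structure FMatroidData (F α : Type*) where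
  ground : Finset α
  rank : ℕ
  reps : Set ((Fin rank → α) → F)

namespace FMatroidData

variable {F F' α : Type*}

/-- `M` is an `F`-matroid: its set of functions is the class `[φ] = {c φ | c ∈ F^×}` of a
Grassmann-Plücker function `φ`. -/
def IsFMatroid [Tract F] (M : FMatroidData F α) : Prop :=
  ∃ φ, IsGrassmannPlucker M.ground M.rank φ ∧
    M.reps = {ψ | ∃ c : Fˣ, ∀ x, ψ x = (c : F) * φ x}

/-- The push-forward `f_* [φ] = [f ∘ φ]`. -/
def push [Tract F] [Tract F'] (f : TractHom F F') (M : FMatroidData F α) : FMatroidData F' α where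
  ground := M.ground
  rank := M.rank
  reps := {ψ | ∃ φ ∈ M.reps, ∃ c : F'ˣ, ∀ x, ψ x = (c : F') * f.toMonoidWithZeroHom (φ x)}

/-- The tuple `x` is an (ordered) basis of the underlying matroid. -/
def IsBasisTuple [Tract F] (M : FMatroidData F α) (x : Fin M.rank → α) : Prop :=
  ∃ φ ∈ M.reps, φ x ≠ 0

/-- `A` is independent in the underlying matroid: it is contained in a basis. -/
def Indep [Tract F] (M : FMatroidData F α) (A : Finset α) : Prop :=
  ∃ x, M.IsBasisTuple x ∧ ∀ e ∈ A, ∃ i, x i = e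

open Classical in
/-- The rank of `A` in the underlying matroid: the largest size of an independent subset. -/
def rk [Tract F] (M : FMatroidData F α) (A : Finset α) : ℕ :=
  (A.powerset.filter M.Indep).sup Finset.card

theorem rk_le [Tract F] (M : FMatroidData F α) (A : Finset α) : M.rk A ≤ M.rank := by
  classical
  refine Finset.sup_le fun B hB => ?_
  obtain ⟨x, -, hx⟩ := (Finset.mem_filter.1 hB).2
  have h : B ⊆ Finset.univ.image x := fun e he => by
    obtain ⟨i, hi⟩ := hx e he
    exact Finset.mem_image.2 ⟨i, Finset.mem_univ _, hi⟩
  calc B.card ≤ (Finset.univ.image x).card := Finset.card_le_card h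
    _ ≤ (Finset.univ : Finset (Fin M.rank)).card := Finset.card_image_le
    _ = M.rank := by simp

open Classical in
/-- The function `(x_1, …, x_k) ↦ φ(x_1, …, x_k, a_1, …, a_l)` on `S^k`, extended by zero. -/
def fixTail [Zero F] (S : Finset α) {r k l : ℕ} (h : r = k + l) (φ : (Fin r → α) → F)
    (a : Fin l → α) : (Fin k → α) → F :=
  fun x => if ∀ i, x i ∈ S then φ (fun i => Fin.append x a (Fin.cast h i)) else 0

/-- The contraction `M / A`. Its class consists of the functions `φ / A`, where `φ` ranges over
the representatives of `M`, and `(a_1, …, a_ℓ)` over the maximal independent subsets of `A`. -/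
def contract [Tract F] [DecidableEq α] (M : FMatroidData F α) (A : Finset α) :
    FMatroidData F α where
  ground := M.ground \ A
  rank := M.rank - M.rk A
  reps := {ψ | ∃ φ ∈ M.reps, ∃ a : Fin (M.rk A) → α, Function.Injective a ∧ (∀ i, a i ∈ A) ∧
    M.Indep (Finset.univ.image a) ∧
    ψ = fixTail (M.ground \ A) (Nat.sub_add_cancel (M.rk_le A)).symm φ a}

/-- The deletion `M \ A`. Its class consists of the functions `φ \ A`, where `φ` ranges over
the representatives of `M`, and `(a_1, …, a_{r-k})` over the bases of `M / (E \ A)`, i.e. the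
tuples in `A` that a basis `(b_1, …, b_k)` of `E \ A` completes to a basis of `M`. -/
def delete [Tract F] [DecidableEq α] (M : FMatroidData F α) (A : Finset α) :
    FMatroidData F α where
  ground := M.ground \ A
  rank := M.rk (M.ground \ A)
  reps := {ψ | ∃ φ ∈ M.reps, ∃ a : Fin (M.rank - M.rk (M.ground \ A)) → α, (∀ i, a i ∈ A) ∧
    (∃ b : Fin (M.rk (M.ground \ A)) → α, (∀ i, b i ∈ M.ground \ A) ∧
      M.IsBasisTuple (fun i => Fin.append b a
        (Fin.cast (Nat.add_sub_of_le (M.rk_le (M.ground \ A))).symm i))) ∧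
    ψ = fixTail (M.ground \ A) (Nat.add_sub_of_le (M.rk_le (M.ground \ A))).symm φ a}

/-- `ψ` is the dual function `φ^*` of `φ : E^r → F` with respect to the involution `τ`:
`φ^*(x) = sign(x, x') τ(φ(x'))` whenever the entries of `x` and `x'` enumerate `E`, and `φ^*`
vanishes on tuples that are not injective or not contained in `E`. Note that `Tuple.sort z` is
the permutation `σ` that makes `z ∘ σ` increasing. -/
def IsDualFunction [Tract F] [LinearOrder α] (τ : TractHom F F) (E : Finset α) {r : ℕ}
    (φ : (Fin r → α) → F) (ψ : (Fin (E.card - r) → α) → F) : Prop :=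
  (∀ (x : Fin (E.card - r) → α) (x' : Fin r → α),
    Finset.univ.image (Fin.append x x') = E →
      ψ x = Tract.ofSign F (Equiv.Perm.sign (Tuple.sort (Fin.append x x'))) *
        τ.toMonoidWithZeroHom (φ x')) ∧
  (∀ x : Fin (E.card - r) → α, ¬ (Function.Injective x ∧ ∀ i, x i ∈ E) → ψ x = 0)

/-- The dual `M^*`, of rank `n - r`, whose class consists of the functions `φ^*` for `φ` in the
class of `M`. -/
def dual [Tract F] [LinearOrder α] (τ : TractHom F F) (M : FMatroidData F α) :
    FMatroidData F α where
  ground := M.ground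
  rank := M.ground.card - M.rank
  reps := {ψ | ∃ φ ∈ M.reps, IsDualFunction τ M.ground φ ψ}

/-- `M` is a quotient of `N`, written `N ↠ M`: all representatives `μ` of `M` and `ν` of `N`
satisfy the Plücker flag relations. -/
def IsQuotientOf [Tract F] (M N : FMatroidData F α) : Prop :=
  ∀ μ ∈ M.reps, ∀ ν ∈ N.reps, FlagRelations M.ground μ ν

end FMatroidData

/-- `(M_1, …, M_s)` is a flag `F`-matroid on `E`: every `M_i` is an `F`-matroid on `E`, and
`M_i` is a quotient of `M_j` for all `i < j`. -/
structure IsFlagMatroid {F α : Type*} [Tract F] (E : Finset α) {s : ℕ}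
    (M : Fin s → FMatroidData F α) : Prop where
  isFMatroid : ∀ i, (M i).IsFMatroid
  ground_eq : ∀ i, (M i).ground = E
  quotient : ∀ i j, i < j → (M i).IsQuotientOf (M j)

namespace FlagMatroid

variable {F F' α : Type*} {s : ℕ}

/-- The dual sequence `(M_s^*, …, M_1^*)`. -/
def dual [Tract F] [LinearOrder α] (τ : TractHom F F) (M : Fin s → FMatroidData F α) :
    Fin s → FMatroidData F α :=
  fun i => (M i.rev).dual τ

/-- The componentwise minor `(M_1 \ I / J, …, M_s \ I / J)`. -/
def minor [Tract F] [DecidableEq α] (M : Fin s → FMatroidData F α) (I J : Finset α) :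
    Fin s → FMatroidData F α :=
  fun i => ((M i).delete I).contract J

/-- The componentwise push-forward `(f_* M_1, …, f_* M_s)`. -/
def push [Tract F] [Tract F'] (f : TractHom F F') (M : Fin s → FMatroidData F α) :
    Fin s → FMatroidData F' α :=
  fun i => (M i).push f

/-- The set of flag `F`-matroids on `E` of rank `r = (r_1, …, r_s)`. -/
def ofRank (F : Type*) [Tract F] (E : Finset α) (r : Fin s → ℕ) :
    Set (Fin s → FMatroidData F α) :=
  {M | IsFlagMatroid E M ∧ ∀ i, (M i).rank = r i}

end FlagMatroid

end

/-! The Plücker flag relations involve signs and an ordering of the entries. Both disappear in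
exchange form: for tuples x, y and a pivot entry x_i, the sum of ε ν(y) μ(x) and of all products ν(y
with x_i in place of y_j) μ(x with y_j in place of x_i) is null. For alternating functions this is
equivalent to the original relations (`flagRelations_iff`), it is visibly preserved by tract
morphisms, and it makes sense for tuples indexed by any finite type. Tuples can therefore be split
into blocks by using sum types as index sets.

Duality replaces a tuple by its complement. The pivot x_i lies in the complement y' of y, and the
entries y_j that can be exchanged lie in the complement x' of x, so a relation for the duals at (x,
y) matches, term by term, a relation for the original functions at (y', x')
(`ExchangeRelations.dual`). The sign in the definition of the dual matters only through its
behaviour under permutations; `IsOrientation` isolates this property, and any two orientations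
differ by a unit, hence define the same class.

A minor fixes a block a of entries in A. If the block has the size of the largest intersection of A
with a basis (contraction) or the smallest (deletion), all exchanges across the boundary of A
vanish, so the relations restrict to the remaining block (`ExchangeRelations.tailFunction`). The
same vanishing leaves two-term relations, which show that different choices of a give proportional
functions (`ExchangeRelations.exists_tail_eq_mul`), so each minor is the class of a single function.

Since complementary tuples have A-counts adding up to |A|, duality turns maximal counts into minimal
ones and thus contraction into deletion. A basis that is extremal for I and J simultaneously
(`exists_common_basis`) shows that contraction and deletion commute. Finally, duality is an
involution on classes, which gives the bijection. -/

set_option linter.unusedSectionVars false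

noncomputable section

open Tract Function

local notation "ε[" F "]" => Units.val (Tract.eps : Units F)

/-! ### Tract arithmetic: two-term null sums and signs -/

namespace Tract

variable {F F' : Type*} [Tract F] [Tract F']

theorem toSemiring_zero : toSemiring (0 : F) = 0 := by simp [toSemiring]

theorem toSemiring_units (u : Fˣ) : toSemiring (u : F) = MonoidAlgebra.of ℕ Fˣ u := by
  simp [toSemiring]

theorem toSemiring_one : toSemiring (1 : F) = 1 := by
  rw [← Units.val_one, toSemiring_units, map_one]

theorem of_mul_toSemiring (u : Fˣ) (a : F) :
    MonoidAlgebra.of ℕ Fˣ u * toSemiring a = toSemiring ((u : F) * a) := by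
  rcases eq_or_ne a 0 with rfl | ha
  · simp [toSemiring_zero]
  · lift a to Fˣ using ha.isUnit
    rw [← Units.val_mul, toSemiring_units, toSemiring_units, map_mul]

theorem smul_mem_iff (u : Fˣ) (x : MonoidAlgebra ℕ Fˣ) :
    MonoidAlgebra.of ℕ Fˣ u * x ∈ nullset (F := F) ↔ x ∈ nullset (F := F) := by
  refine ⟨fun h => ?_, smul_mem u x⟩
  have := smul_mem u⁻¹ _ h
  rwa [← mul_assoc, ← map_mul, inv_mul_cancel, map_one, one_mul] at this

theorem toSemiring_mem_iff (a : F) : toSemiring a ∈ nullset (F := F) ↔ a = 0 := by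
  refine ⟨fun h => ?_, ?_⟩
  · by_contra ha
    lift a to Fˣ using Ne.isUnit ha
    rw [toSemiring_units, ← mul_one (MonoidAlgebra.of ℕ Fˣ a), smul_mem_iff] at h
    exact one_notMem h
  · rintro rfl
    rw [toSemiring_zero]
    exact zero_mem

/-- Multiplying 1 + ε by the inverse of ε shows that the inverse also completes 1 to a null sum, so
uniqueness applies. -/
theorem eps_mul_eps : ε[F] * ε[F] = 1 := by
  have h : 1 + MonoidAlgebra.of ℕ Fˣ (eps (F := F))⁻¹ ∈ nullset (F := F) := by
    have := smul_mem (eps (F := F))⁻¹ _ (one_add_eps_mem (F := F))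
    rwa [mul_add, ← map_mul, inv_mul_cancel, map_one, mul_one, add_comm] at this
  have h' := eps_unique _ h
  rw [← Units.val_mul]
  nth_rewrite 1 [← h']
  simp

theorem eps_mul_eps_mul (a : F) : ε[F] * (ε[F] * a) = a := by
  rw [← mul_assoc, eps_mul_eps, one_mul]

theorem eps_ne_zero : ε[F] ≠ 0 := Units.ne_zero _

/-- After division by a this is the uniqueness of ε. It is the only way in which membership in the
nullset yields an equation between products: relations are reduced to two nonvanishing terms and
then read off. -/
theorem toSemiring_add_mem_iff (a b : F) :
    toSemiring a + toSemiring b ∈ nullset (F := F) ↔ b = ε[F] * a := by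
  rcases eq_or_ne a 0 with rfl | ha
  · simp [toSemiring_zero, toSemiring_mem_iff]
  lift a to Fˣ using ha.isUnit
  rw [← smul_mem_iff a⁻¹, mul_add, of_mul_toSemiring, of_mul_toSemiring]
  rw [← Units.val_mul, inv_mul_cancel, Units.val_one, toSemiring_one]
  constructor
  · intro h
    rcases eq_or_ne b 0 with rfl | hb
    · rw [mul_zero, toSemiring_zero, add_zero] at h
      exact absurd h one_notMem
    lift b to Fˣ using hb.isUnit
    rw [← Units.val_mul, toSemiring_units] at h
    rw [← eps_unique _ h, ← Units.val_mul]
    congr 1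
    rw [mul_comm a⁻¹, inv_mul_cancel_right]
  · rintro rfl
    rw [mul_left_comm, ← Units.val_mul, inv_mul_cancel, Units.val_one, mul_one, toSemiring_units]
    exact one_add_eps_mem

theorem ofSign_one : ofSign F 1 = 1 := by simp [ofSign]

theorem ofSign_neg_one : ofSign F (-1) = ε[F] := by
  have : (-1 : ℤˣ) ≠ 1 := by decide
  simp [ofSign, this]

theorem ofSign_mul (u v : ℤˣ) : ofSign F (u * v) = ofSign F u * ofSign F v := by
  rcases Int.units_eq_one_or u with rfl | rfl <;> rcases Int.units_eq_one_or v with rfl | rfl <;>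
    simp [ofSign_one, ofSign_neg_one, eps_mul_eps]

theorem ofSign_ne_zero (u : ℤˣ) : ofSign F u ≠ 0 := by
  rcases Int.units_eq_one_or u with rfl | rfl <;> simp [ofSign_one, ofSign_neg_one]

theorem ofSign_mul_self (u : ℤˣ) : ofSign F u * ofSign F u = 1 := by
  rw [← ofSign_mul, Int.units_mul_self, ofSign_one]

theorem ofSign_pow (j : ℕ) : ofSign F ((-1) ^ j) = ε[F] ^ j := by
  induction j with
  | zero => simp [ofSign_one]
  | succ j ih => rw [pow_succ, pow_succ, ofSign_mul, ih, ofSign_neg_one]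

end Tract

namespace TractHom

variable {F F' : Type*} [Tract F] [Tract F']

theorem map_ne_zero (f : TractHom F F') {a : F} (ha : a ≠ 0) : f.toMonoidWithZeroHom a ≠ 0 :=
  (_root_.map_ne_zero f.toMonoidWithZeroHom).2 ha

theorem map_sum_mem {ι : Type*} [Fintype ι] (f : TractHom F F') (a : ι → F)
    (h : ∑ i, toSemiring (a i) ∈ nullset (F := F)) :
    ∑ i, toSemiring (f.toMonoidWithZeroHom (a i)) ∈ nullset (F := F') := by
  have e := Fintype.equivFin ι
  have := f.map_null (fun k => a (e.symm k)) (by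
    rw [IsNull, e.symm.sum_comp (fun i => toSemiring (a i))]
    exact h)
  rwa [IsNull, e.symm.sum_comp (fun i => toSemiring (f.toMonoidWithZeroHom (a i)))] at this

theorem map_eps (f : TractHom F F') : f.toMonoidWithZeroHom ε[F] = ε[F'] := by
  have h := f.map_sum_mem ![1, ε[F]] (by
    simpa [toSemiring_one, toSemiring_units] using one_add_eps_mem (F := F))
  simp only [Fin.sum_univ_two, Matrix.cons_val_zero, Matrix.cons_val_one, map_one] at h
  simpa using (toSemiring_add_mem_iff _ _).1 h

theorem map_ofSign (f : TractHom F F') (u : ℤˣ) :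
    f.toMonoidWithZeroHom (ofSign F u) = ofSign F' u := by
  rcases Int.units_eq_one_or u with rfl | rfl <;> simp [ofSign_one, ofSign_neg_one, map_eps]

end TractHom

/-! ### Alternating functions and the sign-free exchange relations -/

section Alternating

variable {F F' α ι κ ι' κ' : Type*} [Tract F] [Tract F']

/-- A function `E^ι → F`, extended by zero, that vanishes on tuples with two equal entries and
changes by the sign of a permutation of the entries. -/
structure IsAlternating [DecidableEq ι] [Fintype ι] (E : Finset α) (φ : (ι → α) → F) : Prop where
  mem_of_ne_zero : ∀ {x}, φ x ≠ 0 → ∀ i, x i ∈ E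
  injective_of_ne_zero : ∀ {x}, φ x ≠ 0 → Injective x
  comp_perm : ∀ x (σ : Equiv.Perm ι), φ (x ∘ σ) = ofSign F (Equiv.Perm.sign σ) * φ x

/-- The Plücker flag relations for `μ : E^ι → F` and `ν : E^κ → F` in exchange form: an entry of
`x` is exchanged in turn for each entry of `y`. -/
def ExchangeAt [DecidableEq ι] [DecidableEq κ] [Fintype κ]
    (μ : (ι → α) → F) (ν : (κ → α) → F) (x : ι → α) (i : ι) (y : κ → α) : Prop :=
  toSemiring (ε[F] * (ν y * μ x)) +
    ∑ j, toSemiring (ν (update y j (x i)) * μ (update x i (y j))) ∈ nullset (F := F)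

/-- `ExchangeAt` holds for all tuples in `E`. -/
def ExchangeRelations [DecidableEq ι] [DecidableEq κ] [Fintype κ] (E : Finset α)
    (μ : (ι → α) → F) (ν : (κ → α) → F) : Prop :=
  ∀ x i y, (∀ i, x i ∈ E) → (∀ j, y j ∈ E) → ExchangeAt μ ν x i y

variable [DecidableEq ι] [DecidableEq κ] [Fintype ι] [Fintype κ]
variable [DecidableEq ι'] [DecidableEq κ'] [Fintype ι'] [Fintype κ']

theorem update_comp_swap (x : ι → α) (i j : ι) (e : α) :
    update x i e ∘ Equiv.swap j i = update (x ∘ Equiv.swap j i) j e := by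
  ext k
  simp only [comp_apply, update_apply]
  rcases eq_or_ne k j with rfl | hk
  · simp
  · rw [if_neg hk, if_neg]
    intro h
    exact hk ((Equiv.injective (Equiv.swap j i)) (h.trans (Equiv.swap_apply_left j i).symm))

theorem update_update_eq_comp_swap (x : ι → α) {i j : ι} (h : i ≠ j) (e : α) :
    update (update x i e) j (x i) = update x j e ∘ Equiv.swap i j := by
  ext k
  simp only [comp_apply, update_apply, Equiv.swap_apply_def]
  split_ifs <;> simp_all

namespace IsAlternating

variable {E : Finset α} {φ : (ι → α) → F}

theorem of_swap (hs : ∀ x, (∃ i, x i ∉ E) → φ x = 0)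
    (hsw : ∀ (x : ι → α) (i j : ι), i ≠ j → φ x = ε[F] * φ (x ∘ Equiv.swap i j))
    (h0 : ∀ (x : ι → α) (i j : ι), i ≠ j → x i = x j → φ x = 0) : IsAlternating E φ where
  mem_of_ne_zero {x} h i := by
    by_contra hi
    exact h (hs x ⟨i, hi⟩)
  injective_of_ne_zero {x} h i j hij := by
    by_contra hne
    exact h (h0 x i j hne hij)
  comp_perm x σ := by
    induction σ using Equiv.Perm.swap_induction_on generalizing x with
    | one => simp [ofSign_one]
    | swap_mul f i j hij ih =>
      rw [Equiv.Perm.coe_mul, ← comp_assoc, ih, Equiv.Perm.sign_mul, Equiv.Perm.sign_swap hij,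
        ofSign_mul, ofSign_neg_one, hsw x i j hij, mul_assoc, mul_left_comm,
        eps_mul_eps_mul]

theorem comp_swap (h : IsAlternating E φ) (x : ι → α) {i j : ι} (hij : i ≠ j) :
    φ (x ∘ Equiv.swap i j) = ε[F] * φ x := by
  rw [h.comp_perm, Equiv.Perm.sign_swap hij, ofSign_neg_one]

theorem eq_zero (h : IsAlternating E φ) {x : ι → α} {i j : ι} (hij : i ≠ j) (hx : x i = x j) :
    φ x = 0 := by
  by_contra h0
  exact hij (h.injective_of_ne_zero h0 hx)

theorem comp_perm_ne_zero (h : IsAlternating E φ) {x : ι → α} (σ : Equiv.Perm ι) :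
    φ (x ∘ σ) ≠ 0 ↔ φ x ≠ 0 := by
  rw [h.comp_perm, mul_ne_zero_iff]
  exact and_iff_right (ofSign_ne_zero _)

theorem reindex (h : IsAlternating E φ) (e : ι ≃ ι') :
    IsAlternating E (fun x : ι' → α => φ (x ∘ e)) where
  mem_of_ne_zero {x} hx i := by simpa using h.mem_of_ne_zero hx (e.symm i)
  injective_of_ne_zero {x} hx := (Injective.of_comp_iff' _ e.bijective).1 (h.injective_of_ne_zero hx)
  comp_perm x σ := by
    have : (x ∘ σ) ∘ e = (x ∘ e) ∘ (e.symm.permCongr σ) := by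
      ext; simp
    rw [this, h.comp_perm, Equiv.Perm.sign_permCongr]

theorem smul (h : IsAlternating E φ) (c : F) : IsAlternating E (fun x => c * φ x) where
  mem_of_ne_zero hx := h.mem_of_ne_zero (right_ne_zero_of_mul hx)
  injective_of_ne_zero hx := h.injective_of_ne_zero (right_ne_zero_of_mul hx)
  comp_perm x σ := by rw [h.comp_perm, mul_left_comm]

end IsAlternating

theorem ExchangeRelations.reindex {E : Finset α} {μ : (ι → α) → F} {ν : (κ → α) → F}
    (h : ExchangeRelations E μ ν) (e : ι ≃ ι') (e' : κ ≃ κ') :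
    ExchangeRelations E (fun x : ι' → α => μ (x ∘ e)) (fun y : κ' → α => ν (y ∘ e')) := by
  intro x i y hx hy
  have := h (x ∘ e) (e.symm i) (y ∘ e') (fun _ => hx _) (fun _ => hy _)
  unfold ExchangeAt at this ⊢
  rw [← e'.sum_comp]
  simpa [update_comp_equiv] using this

theorem ExchangeRelations.smul {E : Finset α} {μ : (ι → α) → F} {ν : (κ → α) → F}
    (h : ExchangeRelations E μ ν) (c d : Fˣ) :
    ExchangeRelations E (fun x => (c : F) * μ x) (fun y => (d : F) * ν y) := by
  intro x i y hx hy
  have := smul_mem (c * d) _ (h x i y hx hy)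
  rw [mul_add, Finset.mul_sum] at this
  simp only [of_mul_toSemiring] at this
  unfold ExchangeAt
  simp only [Units.val_mul] at this
  convert this using 2
  · refine congrArg toSemiring ?_
    beta_reduce
    ac_rfl
  · refine Finset.sum_congr rfl fun j _ => congrArg toSemiring ?_
    beta_reduce
    ac_rfl

theorem ExchangeRelations.map (f : TractHom F F') {E : Finset α} {μ : (ι → α) → F}
    {ν : (κ → α) → F} (h : ExchangeRelations E μ ν) :
    ExchangeRelations E (fun x => f.toMonoidWithZeroHom (μ x))
      (fun y => f.toMonoidWithZeroHom (ν y)) := by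
  intro x i y hx hy
  have := f.map_sum_mem (fun o : Option κ => o.elim (ε[F] * (ν y * μ x))
    (fun j => ν (update y j (x i)) * μ (update x i (y j))))
    (by simpa [Fintype.sum_option, ExchangeAt] using h x i y hx hy)
  simpa [ExchangeAt, Fintype.sum_option, f.map_eps] using this

/-- Exchanging the pivot entry `x i` with an entry of `y` yields an equivalent relation. -/
theorem ExchangeAt.of_exchange {E : Finset α} {μ : (ι → α) → F} {ν : (κ → α) → F}
    (hν : IsAlternating E ν) {x : ι → α} {i : ι} {y : κ → α} (j : κ)
    (h : ExchangeAt μ ν (update x i (y j)) i (update y j (x i))) : ExchangeAt μ ν x i y := by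
  unfold ExchangeAt at h ⊢
  -- The given relation is ε times the desired one: the leading term and the j-th summand trade
  -- places, and in every other summand the tuple of ν changes by the transposition of j and k.
  rw [← smul_mem_iff eps, mul_add, Finset.mul_sum, of_mul_toSemiring, eps_mul_eps_mul]
  simp only [of_mul_toSemiring]
  rw [← Finset.add_sum_erase _ _ (Finset.mem_univ j)] at h ⊢
  have key : ∀ k ∈ Finset.univ.erase j,
      toSemiring (ν (update (update y j (x i)) k (update x i (y j) i)) *
        μ (update (update x i (y j)) i (update y j (x i) k))) =
      toSemiring (ε[F] * (ν (update y k (x i)) * μ (update x i (y k)))) := by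
    intro k hk
    have hk : k ≠ j := Finset.ne_of_mem_erase hk
    rw [update_self, update_update_eq_comp_swap y hk.symm, hν.comp_swap _ hk.symm,
      update_idem, update_of_ne hk, mul_assoc]
  rw [Finset.sum_congr rfl key] at h
  simp only [update_self, update_idem, update_eq_self] at h
  rwa [add_left_comm] at h

/-- The exchange relations only have to be checked for injective tuples such that the pivot entry
does not occur in the second tuple. -/
theorem ExchangeRelations.of_injective {E : Finset α} {μ : (ι → α) → F} {ν : (κ → α) → F}
    (hμ : IsAlternating E μ) (hν : IsAlternating E ν)
    (h : ∀ x i y, (∀ i, x i ∈ E) → (∀ j, y j ∈ E) → Injective x → Injective y →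
      x i ∉ Set.range y → ExchangeAt μ ν x i y) : ExchangeRelations E μ ν := by
  have h1 : ∀ x i y, (∀ i, x i ∈ E) → (∀ j, y j ∈ E) → Injective x → ExchangeAt μ ν x i y := by
    intro x i y hx hy hxi
    by_cases hyi : Injective y
    · by_cases hi : x i ∈ Set.range y
      -- If x_i = y_j, the other summands repeat x_i in ν, and the j-th summand cancels the leading
      -- term.
      · obtain ⟨j, hj⟩ := hi
        unfold ExchangeAt
        rw [Finset.sum_eq_single j]
        · rw [← hj, update_eq_self, hj, update_eq_self, add_comm, toSemiring_add_mem_iff]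
        · intro k _ hk
          rw [hν.eq_zero hk, zero_mul, toSemiring_zero]
          rw [update_self, update_of_ne hk.symm, hj]
        · simp
      · exact h x i y hx hy hxi hyi hi
    -- If y_a = y_b, only the summands a and b can survive, and they differ by a transposition in ν,
    -- that is, by ε.
    · obtain ⟨a, b, hab, hne⟩ : ∃ a b, y a = y b ∧ a ≠ b := by
        simpa [Injective] using hyi
      unfold ExchangeAt
      rw [hν.eq_zero hne hab, zero_mul, mul_zero, toSemiring_zero, zero_add,
        Finset.sum_eq_add_of_mem a b (Finset.mem_univ _) (Finset.mem_univ _) hne,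
        toSemiring_add_mem_iff, ← hab, ← mul_assoc, ← hν.comp_swap _ hne]
      · congr 2
        ext k
        simp only [comp_apply, update_apply, Equiv.swap_apply_def]
        split_ifs <;> simp_all
      · rintro c - ⟨hca, hcb⟩
        rw [hν.eq_zero hne, zero_mul, toSemiring_zero]
        rw [update_of_ne hca.symm, update_of_ne hcb.symm, hab]
  intro x i y hx hy
  -- For a non-injective x, either one exchange makes it injective, which reduces to the case above,
  -- or μ vanishes in every term.
  by_cases hj : ∃ j, Injective (update x i (y j))
  · obtain ⟨j, hj⟩ := hj
    refine ExchangeAt.of_exchange hν j (h1 _ _ _ ?_ ?_ hj)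
    · intro k; rw [update_apply]; split_ifs <;> simp [hx, hy]
    · intro k; rw [update_apply]; split_ifs <;> simp [hx, hy]
  · by_cases hxi : Injective x
    · exact h1 x i y hx hy hxi
    have h0 : ∀ z, ¬ Injective z → μ z = 0 := fun z hz => by
      by_contra hne
      exact hz (hμ.injective_of_ne_zero hne)
    push Not at hj
    unfold ExchangeAt
    rw [h0 x hxi, mul_zero, mul_zero, toSemiring_zero, zero_add]
    simp [h0 _ (hj _), toSemiring_zero, Tract.zero_mem]

/-- Moving the pivot to another position multiplies every term by the same ε. This allows the pivot
to be put first, as in the Plücker relations. -/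
theorem ExchangeAt.of_comp_swap {E : Finset α} {μ : (ι → α) → F} {ν : (κ → α) → F}
    (hμ : IsAlternating E μ) {x : ι → α} {i : ι} {y : κ → α} (i₀ : ι)
    (h : ExchangeAt μ ν (x ∘ Equiv.swap i₀ i) i₀ y) : ExchangeAt μ ν x i y := by
  rcases eq_or_ne i₀ i with rfl | hi
  · simpa using h
  unfold ExchangeAt at h ⊢
  rw [← smul_mem_iff eps, mul_add, Finset.mul_sum, of_mul_toSemiring]
  simp only [of_mul_toSemiring]
  simp only [← update_comp_swap, hμ.comp_swap _ hi, comp_apply, Equiv.swap_apply_left] at h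
  convert h using 4 <;> ac_rfl

end Alternating

/-- The entry y_0 serves as pivot and the remaining entries as second tuple. Omitting y_{j+1} from y
and moving y_0 into the gap is a cycle of sign (-1)^j, which absorbs the coefficient ε^(j+2); only
the leading term keeps its ε. -/
theorem exchangeAt_iff_of_fin {F α : Type*} [Tract F] {E : Finset α} {m w : ℕ}
    {μ : (Fin (m + 1) → α) → F} {ν : (Fin w → α) → F} (hν : IsAlternating E ν)
    (x : Fin m → α) (y : Fin (w + 1) → α) :
    Tract.IsNull (fun k : Fin (w + 1) => ε[F] ^ ((k : ℕ) + 1) * ν (fun i => y (k.succAbove i)) *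
        μ (Fin.cons (y k) x)) ↔
      ExchangeAt μ ν (Fin.cons (y 0) x : Fin (m + 1) → α) 0 (Fin.tail y) := by
  unfold Tract.IsNull ExchangeAt
  rw [Fin.sum_univ_succ]
  have key : ∀ j : Fin w, ε[F] ^ ((j.succ : ℕ) + 1) * ν (fun i => y (j.succ.succAbove i)) =
      ν (update (Fin.tail y) j (y 0)) := by
    intro j
    have : update (Fin.tail y) j (y 0) = (fun i => y (j.succ.succAbove i)) ∘ j.cycleRange := by
      ext i
      simp only [comp_apply, Fin.succAbove_cycleRange]
      rcases eq_or_ne i j with rfl | hij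
      · simp
      · rw [update_of_ne hij, Equiv.swap_apply_of_ne_of_ne (Fin.succ_ne_zero i)
          (by simpa using hij)]
        rfl
    rw [this, hν.comp_perm, Fin.sign_cycleRange, ofSign_pow, Fin.val_succ, pow_succ, pow_succ,
      mul_assoc (ε[F] ^ _), eps_mul_eps, mul_one]
  simp only [key, Fin.cons_zero, Fin.update_cons_zero, Fin.val_zero, zero_add, pow_one, mul_assoc]
  rfl

theorem flagRelations_iff {F α : Type*} [Tract F] {E : Finset α} {r w : ℕ}
    {μ : (Fin r → α) → F} {ν : (Fin w → α) → F} (hμ : IsAlternating E μ)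
    (hν : IsAlternating E ν) : FlagRelations E μ ν ↔ ExchangeRelations E μ ν := by
  constructor
  · intro h x i y hx hy
    obtain ⟨m, rfl⟩ : ∃ m, r = m + 1 := ⟨r - 1, by have := i.pos; omega⟩
    refine ExchangeAt.of_comp_swap hμ 0 ?_
    set x' := x ∘ Equiv.swap 0 i
    have hx' : ∀ i, x' i ∈ E := fun _ => hx _
    have := (exchangeAt_iff_of_fin hν (Fin.tail x') (Fin.cons (x' 0) y)).1
      (h m rfl (Fin.tail x') (Fin.cons (x' 0) y) (fun _ => hx' _)
        (fun j => Fin.cases (hx' 0) hy j))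
    simpa using this
  · rintro h m rfl x y hx hy
    exact (exchangeAt_iff_of_fin hν x y).2
      (h _ _ _ (fun i => Fin.cases (hy 0) hx i) (fun _ => hy _))

theorem isGrassmannPlucker_iff {F α : Type*} [Tract F] {E : Finset α} {r : ℕ}
    {φ : (Fin r → α) → F} : IsGrassmannPlucker E r φ ↔
      IsAlternating E φ ∧ (∃ x, φ x ≠ 0) ∧ ExchangeRelations E φ φ := by
  constructor
  · intro h
    have ha := IsAlternating.of_swap h.support h.swap h.eq_zero
    exact ⟨ha, h.nonzero, (flagRelations_iff ha ha).1 h.plucker⟩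
  · rintro ⟨ha, h0, he⟩
    refine ⟨?_, h0, ?_, fun x i j => ha.eq_zero, (flagRelations_iff ha ha).2 he⟩
    · rintro x ⟨i, hi⟩
      by_contra hx
      exact hi (ha.mem_of_ne_zero hx i)
    · intro x i j hij
      rw [ha.comp_swap x hij, eps_mul_eps_mul]

/-! ### Enumerations and orientations of the ground set -/

section Enumeration

variable {F F' α ι κ ω ω' : Type*} [Tract F] [Tract F']

/-- The tuple `z` enumerates `E` without repetitions. -/
structure IsEnumeration (E : Finset α) (z : ω → α) : Prop where
  injective : Injective z
  mem_iff : ∀ e, e ∈ E ↔ ∃ i, z i = e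

theorem exists_perm_of_injective {z z' : ω → α} (hz : Injective z) (hz' : Injective z')
    (h : ∀ e, (∃ i, z i = e) ↔ ∃ i, z' i = e) : ∃ σ : Equiv.Perm ω, z' = z ∘ σ := by
  have hr : Set.range z' = Set.range z := by
    ext e
    exact (h e).symm
  refine ⟨(Equiv.ofInjective z' hz').trans
    ((Equiv.setCongr hr).trans (Equiv.ofInjective z hz).symm), ?_⟩
  ext i
  simp only [comp_apply, Equiv.trans_apply]
  exact (Equiv.apply_ofInjective_symm hz ⟨z' i, hr ▸ ⟨i, rfl⟩⟩).symm

namespace IsEnumeration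

variable {E : Finset α}

theorem mem {z : ω → α} (h : IsEnumeration E z) (i : ω) : z i ∈ E := (h.mem_iff _).2 ⟨i, rfl⟩

theorem exists_perm {z z' : ω → α} (h : IsEnumeration E z) (h' : IsEnumeration E z') :
    ∃ σ : Equiv.Perm ω, z' = z ∘ σ :=
  exists_perm_of_injective h.injective h'.injective fun e => by rw [← h.mem_iff, ← h'.mem_iff]

theorem reindex {z : ω → α} (h : IsEnumeration E z) (e : ω' ≃ ω) : IsEnumeration E (z ∘ e) where
  injective := h.injective.comp e.injective
  mem_iff a := by
    rw [h.mem_iff, ← e.exists_congr_left.symm]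
    simp

theorem sum_swap {x : κ → α} {y : ι → α} (h : IsEnumeration E (Sum.elim x y)) :
    IsEnumeration E (Sum.elim y x) := by
  have := h.reindex (Equiv.sumComm ι κ)
  convert this using 1
  ext i
  cases i <;> rfl

theorem exists_perm_right {x : κ → α} {y y' : ι → α} (h : IsEnumeration E (Sum.elim x y))
    (h' : IsEnumeration E (Sum.elim x y')) : ∃ σ : Equiv.Perm ι, y' = y ∘ σ := by
  have key : ∀ {y y' : ι → α}, IsEnumeration E (Sum.elim x y) → IsEnumeration E (Sum.elim x y') →
      ∀ i, ∃ j, y' j = y i := by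
    intro y y' h h' i
    obtain ⟨j | j, hj⟩ := (h'.mem_iff (y i)).1 (h.mem (Sum.inr i))
    · exact absurd (h.injective (a₁ := Sum.inl j) (a₂ := Sum.inr i) hj) (by simp)
    · exact ⟨j, hj⟩
  refine exists_perm_of_injective (h.injective.comp Sum.inr_injective)
    (h'.injective.comp Sum.inr_injective) fun e => ⟨?_, ?_⟩
  · rintro ⟨i, rfl⟩
    exact key h h' i
  · rintro ⟨i, rfl⟩
    exact key h' h i

theorem exists_right {x : κ → α} {y : ι → α} (h : IsEnumeration E (Sum.elim x y)) {e : α}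
    (he : e ∈ E) (hx : ∀ k, x k ≠ e) : ∃ i, y i = e := by
  obtain ⟨j | j, hj⟩ := (h.mem_iff e).1 he
  · exact absurd hj (hx j)
  · exact ⟨j, hj⟩

theorem ne {x : κ → α} {y : ι → α} (h : IsEnumeration E (Sum.elim x y)) (k : κ) (i : ι) :
    x k ≠ y i := fun hj => by
  have := h.injective (a₁ := Sum.inl k) (a₂ := Sum.inr i) hj
  simp at this

theorem left_injective {x : κ → α} {y : ι → α} (h : IsEnumeration E (Sum.elim x y)) :
    Injective x := h.injective.comp Sum.inl_injective

theorem right_injective {x : κ → α} {y : ι → α} (h : IsEnumeration E (Sum.elim x y)) :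
    Injective y := h.injective.comp Sum.inr_injective

theorem left_mem {x : κ → α} {y : ι → α} (h : IsEnumeration E (Sum.elim x y)) (k : κ) :
    x k ∈ E := h.mem (Sum.inl k)

theorem right_mem {x : κ → α} {y : ι → α} (h : IsEnumeration E (Sum.elim x y)) (i : ι) :
    y i ∈ E := h.mem (Sum.inr i)

theorem sum_elim [DecidableEq α] {A : Finset α} (hA : A ⊆ E) {z : ω → α} {w : ω' → α}
    (hz : IsEnumeration (E \ A) z) (hw : IsEnumeration A w) : IsEnumeration E (Sum.elim z w) where
  injective := hz.injective.sumElim hw.injective fun i j hij =>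
    (Finset.mem_sdiff.1 (hz.mem i)).2 (hij ▸ hw.mem j)
  mem_iff e := by
    rw [Sum.exists]
    simp only [Sum.elim_inl, Sum.elim_inr]
    rw [← hz.mem_iff, ← hw.mem_iff, Finset.mem_sdiff]
    have := @hA e
    tauto

end IsEnumeration

/-- An injective tuple in `E` can be completed to an enumeration of `E`. -/
theorem exists_isEnumeration [Fintype κ] [Fintype ι] {E : Finset α}
    (hc : Fintype.card κ + Fintype.card ι = E.card) {x : κ → α} (hx : Injective x)
    (hE : ∀ k, x k ∈ E) : ∃ y : ι → α, IsEnumeration E (Sum.elim x y) := by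
  classical
  have hsub : Finset.univ.image x ⊆ E := by
    intro e he
    obtain ⟨k, -, rfl⟩ := Finset.mem_image.1 he
    exact hE k
  have hcard : Fintype.card ι = Fintype.card ↥(E \ Finset.univ.image x) := by
    rw [Fintype.card_coe, Finset.card_sdiff_of_subset hsub,
      Finset.card_image_of_injective _ hx, Finset.card_univ]
    omega
  obtain ⟨e⟩ := Fintype.card_eq.1 hcard
  have hmem : ∀ i, (e i : α) ∈ E ∧ ∀ k, x k ≠ e i := by
    intro i
    have h := Finset.mem_sdiff.1 (e i).2
    exact ⟨h.1, fun k hk => h.2 (Finset.mem_image.2 ⟨k, Finset.mem_univ _, hk⟩)⟩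
  refine ⟨fun i => e i, hx.sumElim (Subtype.val_injective.comp e.injective)
    fun k i => (hmem i).2 k, fun a => ⟨fun ha => ?_, ?_⟩⟩
  · by_cases h : ∃ k, x k = a
    · obtain ⟨k, rfl⟩ := h
      exact ⟨Sum.inl k, rfl⟩
    · refine ⟨Sum.inr (e.symm ⟨a, ?_⟩), by simp⟩
      push Not at h
      simpa using ⟨ha, h⟩
  · rintro ⟨k | i, rfl⟩
    · exact hE k
    · exact (hmem i).1

theorem exists_isEnumeration_left [Fintype κ] [Fintype ι] {E : Finset α}
    (hc : Fintype.card κ + Fintype.card ι = E.card) {y : ι → α} (hy : Injective y)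
    (hE : ∀ k, y k ∈ E) : ∃ x : κ → α, IsEnumeration E (Sum.elim x y) := by
  obtain ⟨x, hx⟩ := exists_isEnumeration (ι := κ) (by omega) hy hE
  exact ⟨x, hx.sum_swap⟩

/-- A nowhere zero function on the enumerations of `E` that changes by the sign of a permutation
of the entries. -/
structure IsOrientation [DecidableEq ω] [Fintype ω] (E : Finset α) (s : (ω → α) → F) : Prop where
  ne_zero : ∀ {z}, IsEnumeration E z → s z ≠ 0
  comp_perm : ∀ {z}, IsEnumeration E z → ∀ σ : Equiv.Perm ω,
    s (z ∘ σ) = ofSign F (Equiv.Perm.sign σ) * s z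

variable [DecidableEq ι] [DecidableEq κ] [Fintype ι] [Fintype κ]
variable [DecidableEq ω] [DecidableEq ω'] [Fintype ω] [Fintype ω']

namespace IsOrientation

variable {E : Finset α} {s : (ω → α) → F}

theorem comp_swap (h : IsOrientation E s) {z : ω → α} (hz : IsEnumeration E z) {i j : ω}
    (hij : i ≠ j) : s (z ∘ Equiv.swap i j) = ε[F] * s z := by
  rw [h.comp_perm hz, Equiv.Perm.sign_swap hij, ofSign_neg_one]

theorem reindex (h : IsOrientation E s) (e : ω ≃ ω') :
    IsOrientation E (fun z : ω' → α => s (z ∘ e)) where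
  ne_zero hz := h.ne_zero (hz.reindex e)
  comp_perm {z} hz σ := by
    have : (z ∘ σ) ∘ e = (z ∘ e) ∘ (e.symm.permCongr σ) := by
      ext; simp
    rw [this, h.comp_perm (hz.reindex e), Equiv.Perm.sign_permCongr]

/-- Signs are their own inverses, so inversion preserves the transformation rule. This is the
orientation that recovers a function from its dual. -/
theorem map_inv (h : IsOrientation E s) (f : TractHom F F') :
    IsOrientation E (fun z => (f.toMonoidWithZeroHom (s z))⁻¹) where
  ne_zero hz := inv_ne_zero (f.map_ne_zero (h.ne_zero hz))
  comp_perm {z} hz σ := by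
    rw [h.comp_perm hz, map_mul, f.map_ofSign, mul_inv,
      inv_eq_of_mul_eq_one_left (ofSign_mul_self (F := F') _)]

/-- Freezing the block that enumerates A orients the complement, because a permutation acting on one
block only keeps its sign. -/
theorem restrict [DecidableEq α] {A : Finset α} (hA : A ⊆ E) {s : (ω ⊕ ω' → α) → F}
    (h : IsOrientation E s) {w : ω' → α} (hw : IsEnumeration A w) :
    IsOrientation (E \ A) (fun z => s (Sum.elim z w)) where
  ne_zero hz := h.ne_zero (hz.sum_elim hA hw)
  comp_perm {z} hz σ := by
    have : Sum.elim (z ∘ σ) w = Sum.elim z w ∘ Equiv.Perm.sumCongr σ 1 := by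
      ext i
      cases i <;> rfl
    rw [this, h.comp_perm (hz.sum_elim hA hw), Equiv.Perm.sign_sumCongr, Equiv.Perm.sign_one,
      mul_one]

/-- Two orientations of `E` differ by a unit. -/
theorem exists_eq_mul {s' : (ω → α) → F} (h : IsOrientation E s) (h' : IsOrientation E s') :
    ∃ c : Fˣ, ∀ z, IsEnumeration E z → s' z = c * s z := by
  by_cases hz : ∃ z : ω → α, IsEnumeration E z
  · obtain ⟨z, hz⟩ := hz
    refine ⟨(Units.mk0 _ (h'.ne_zero hz)) * (Units.mk0 _ (h.ne_zero hz))⁻¹, fun z' hz' => ?_⟩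
    obtain ⟨σ, rfl⟩ := hz.exists_perm hz'
    rw [h.comp_perm hz, h'.comp_perm hz]
    have := h.ne_zero hz
    simp only [Units.val_mul, Units.val_mk0, Units.val_inv_eq_inv_val]
    rw [mul_assoc, mul_left_comm (s z)⁻¹, inv_mul_cancel₀ this, mul_one, mul_comm]
  · exact ⟨1, fun z h => absurd ⟨z, h⟩ hz⟩

end IsOrientation

/-- `ψ` is the dual function of `φ` with respect to the orientation `s` of `E`. -/
structure IsDualWith (τ : TractHom F F) (E : Finset α) (s : (κ ⊕ ι → α) → F) (φ : (ι → α) → F)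
    (ψ : (κ → α) → F) : Prop where
  apply : ∀ x x', IsEnumeration E (Sum.elim x x') →
    ψ x = s (Sum.elim x x') * τ.toMonoidWithZeroHom (φ x')
  eq_zero : ∀ x, ¬ (Injective x ∧ ∀ i, x i ∈ E) → ψ x = 0

/-! ### Duality of functions with respect to an orientation -/

section Dual

variable {E : Finset α} {τ : TractHom F F} {s : (κ ⊕ ι → α) → F} {φ : (ι → α) → F}
  {ψ : (κ → α) → F}

/-- The value does not depend on the order of the complement: permuting it changes both the
orientation and φ by the same sign, and signs square to 1. -/
theorem exists_isDualWith (τ : TractHom F F) (hs : IsOrientation E s) (hφ : IsAlternating E φ) :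
    ∃ ψ : (κ → α) → F, IsDualWith τ E s φ ψ := by
  classical
  refine ⟨fun x => if h : ∃ x', IsEnumeration E (Sum.elim x x') then
    s (Sum.elim x h.choose) * τ.toMonoidWithZeroHom (φ h.choose) else 0, ?_, ?_⟩
  · intro x x' hx
    have h : ∃ x', IsEnumeration E (Sum.elim x x') := ⟨x', hx⟩
    rw [dif_pos h]
    obtain ⟨σ, hσ⟩ := hx.exists_perm_right h.choose_spec
    rw [hσ]
    have : Sum.elim x (x' ∘ σ) = Sum.elim x x' ∘ Equiv.Perm.sumCongr 1 σ := by
      ext i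
      cases i <;> rfl
    rw [this, hs.comp_perm hx, Equiv.Perm.sign_sumCongr, Equiv.Perm.sign_one, one_mul,
      hφ.comp_perm, map_mul, τ.map_ofSign, mul_mul_mul_comm, ofSign_mul_self, one_mul]
  · intro x hx
    refine dif_neg ?_
    rintro ⟨x', h⟩
    exact hx ⟨h.left_injective, h.left_mem⟩

namespace IsDualWith

theorem isAlternating (h : IsDualWith τ E s φ ψ) (hs : IsOrientation E s)
    (hc : Fintype.card κ + Fintype.card ι = E.card) : IsAlternating E ψ where
  mem_of_ne_zero {x} hx := by
    by_contra hn
    exact hx (h.eq_zero x fun hh => hn hh.2)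
  injective_of_ne_zero {x} hx := by
    by_contra hn
    exact hx (h.eq_zero x fun hh => hn hh.1)
  comp_perm x σ := by
    by_cases hx : Injective x ∧ ∀ i, x i ∈ E
    · obtain ⟨x', hx'⟩ := exists_isEnumeration hc hx.1 hx.2
      have : Sum.elim (x ∘ σ) x' = Sum.elim x x' ∘ Equiv.Perm.sumCongr σ 1 := by
        ext i
        cases i <;> rfl
      rw [h.apply x x' hx', h.apply (x ∘ σ) x' (by rw [this]; exact hx'.reindex _), this,
        hs.comp_perm hx', Equiv.Perm.sign_sumCongr, Equiv.Perm.sign_one, mul_one, mul_assoc]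
    · rw [h.eq_zero x hx, mul_zero, h.eq_zero]
      rintro ⟨h1, h2⟩
      exact hx ⟨(Injective.of_comp_iff' _ σ.bijective).1 h1, fun i => by simpa using h2 (σ.symm i)⟩

theorem apply_ne_zero_iff (h : IsDualWith τ E s φ ψ) (hs : IsOrientation E s) {x : κ → α}
    {x' : ι → α} (hx : IsEnumeration E (Sum.elim x x')) : ψ x ≠ 0 ↔ φ x' ≠ 0 := by
  rw [h.apply x x' hx, mul_ne_zero_iff]
  exact ⟨fun hh h0 => hh.2 (by rw [h0, map_zero]), fun hh => ⟨hs.ne_zero hx, τ.map_ne_zero hh⟩⟩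

theorem exists_ne_zero (h : IsDualWith τ E s φ ψ) (hs : IsOrientation E s)
    (hc : Fintype.card κ + Fintype.card ι = E.card) (hφ : IsAlternating E φ)
    (h0 : ∃ x, φ x ≠ 0) : ∃ x, ψ x ≠ 0 := by
  obtain ⟨x', hx'⟩ := h0
  obtain ⟨x, hx⟩ := exists_isEnumeration_left (κ := κ) hc (hφ.injective_of_ne_zero hx')
    (hφ.mem_of_ne_zero hx')
  exact ⟨x, (h.apply_ne_zero_iff hs hx).2 hx'⟩

/-- The dual of the dual. -/
theorem symm (h : IsDualWith τ E s φ ψ) (hs : IsOrientation E s) (hτ : τ.IsInvolution)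
    (hφ : IsAlternating E φ) :
    IsDualWith τ E (fun z : ι ⊕ κ → α => (τ.toMonoidWithZeroHom (s (z ∘ Equiv.sumComm κ ι)))⁻¹)
      ψ φ where
  apply x x' hx := by
    have : Sum.elim x x' ∘ Equiv.sumComm κ ι = Sum.elim x' x := by
      ext i
      cases i <;> rfl
    simp only [this]
    rw [h.apply x' x hx.sum_swap, map_mul, hτ, inv_mul_cancel_left₀]
    exact τ.map_ne_zero (hs.ne_zero hx.sum_swap)
  eq_zero x hx := by
    by_contra h0
    exact hx ⟨hφ.injective_of_ne_zero h0, hφ.mem_of_ne_zero h0⟩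

/-- Exchanging an entry with one of the complement is a transposition of the whole enumeration,
which accounts for the factor ε. -/
theorem apply_update (h : IsDualWith τ E s φ ψ) (hs : IsOrientation E s) {x : κ → α} {x' : ι → α}
    (hx : IsEnumeration E (Sum.elim x x')) (k : κ) (i : ι) :
    ψ (update x k (x' i)) =
      ε[F] * s (Sum.elim x x') * τ.toMonoidWithZeroHom (φ (update x' i (x k))) := by
  have : Sum.elim (update x k (x' i)) (update x' i (x k)) =
      Sum.elim x x' ∘ Equiv.swap (Sum.inl k) (Sum.inr i) := by
    ext j
    rcases j with j | j
    · rcases eq_or_ne j k with rfl | hj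
      · simp
      · rw [comp_apply, Equiv.swap_apply_of_ne_of_ne (by simpa using hj) (by simp)]
        simp [hj]
    · rcases eq_or_ne j i with rfl | hj
      · simp
      · rw [comp_apply, Equiv.swap_apply_of_ne_of_ne (by simp) (by simpa using hj)]
        simp [hj]
  rw [h.apply _ (update x' i (x k)) (by rw [this]; exact hx.reindex _), this,
    hs.comp_swap hx (by simp)]

end IsDualWith

/-- Duality reverses the Plücker flag relations. -/
theorem ExchangeRelations.dual {ι' κ' : Type*} [DecidableEq ι'] [DecidableEq κ'] [Fintype ι']
    [Fintype κ'] {μ : (ι → α) → F} {ν : (κ → α) → F} {μ' : (ι' → α) → F} {ν' : (κ' → α) → F}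
    {s : (ι' ⊕ ι → α) → F} {t : (κ' ⊕ κ → α) → F} (h : ExchangeRelations E μ ν)
    (hμ : IsAlternating E μ)
    (hs : IsOrientation E s) (ht : IsOrientation E t) (hμ' : IsDualWith τ E s μ μ')
    (hν' : IsDualWith τ E t ν ν') (hι : Fintype.card ι' + Fintype.card ι = E.card)
    (hκ : Fintype.card κ' + Fintype.card κ = E.card) : ExchangeRelations E ν' μ' := by
  have aμ' := hμ'.isAlternating hs hι
  have aν' := hν'.isAlternating ht hκ
  refine .of_injective aν' aμ' fun x i y hxE hyE hx hy hxy => ?_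
  obtain ⟨x', hx'⟩ := exists_isEnumeration hκ hx hxE
  obtain ⟨y', hy'⟩ := exists_isEnumeration hι hy hyE
  -- As x_i does not occur in y, it is an entry of the complement y' and can serve as pivot for the
  -- original functions.
  obtain ⟨i', hi'⟩ := hy'.exists_right (hxE i) fun k hk => hxy ⟨k, hk⟩
  have H := (h.map τ) y' i' x' hy'.right_mem hx'.right_mem
  -- The product of the two orientation values is the common factor of all terms; in the exchanged
  -- terms the two extra factors ε cancel.
  let c : Fˣ := Units.mk0 _ (hs.ne_zero hy') * Units.mk0 _ (ht.ne_zero hx')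
  have H := smul_mem c _ H
  have hc : (c : F) = s (Sum.elim y y') * t (Sum.elim x x') := rfl
  rw [mul_add, Finset.mul_sum] at H
  simp only [of_mul_toSemiring] at H
  unfold ExchangeAt
  convert H using 2
  · rw [hμ'.apply y y' hy', hν'.apply x x' hx', hc]
    refine congrArg toSemiring ?_
    ac_rfl
  have e1 : ∀ j j', y j = x' j' → toSemiring (μ' (update y j (x i)) * ν' (update x i (y j))) =
      toSemiring (c * (τ.toMonoidWithZeroHom (ν (update x' j' (y' i'))) *
        τ.toMonoidWithZeroHom (μ (update y' i' (x' j'))))) := by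
    intro j j' hj
    rw [← hi', hμ'.apply_update hs hy', hj, hi', hν'.apply_update ht hx', hc]
    refine congrArg toSemiring ?_
    generalize s _ = a, t _ = b, τ.toMonoidWithZeroHom (μ _) = m,
      τ.toMonoidWithZeroHom (ν _) = n
    calc ε[F] * a * m * (ε[F] * b * n) = ε[F] * ε[F] * (a * b * (n * m)) := by ac_rfl
      _ = a * b * (n * m) := by rw [eps_mul_eps, one_mul]
  -- If y_j is not in x', it occurs in x at a place other than i, so exchanging it for x_i creates a
  -- repetition and the summand vanishes. The symmetric argument for x' makes the nonzero summands
  -- correspond bijectively.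
  have hg : ∀ j, toSemiring (μ' (update y j (x i)) * ν' (update x i (y j))) ≠ 0 →
      ∃ j', x' j' = y j := by
    intro j hj
    refine hx'.exists_right (hyE j) fun k hk => ?_
    rcases eq_or_ne k i with rfl | hki
    · exact hxy ⟨j, hk.symm⟩
    · apply hj
      rw [aν'.eq_zero hki, mul_zero, toSemiring_zero]
      rw [update_of_ne hki, update_self, hk]
  choose g hg using hg
  refine Finset.sum_bij_ne_zero (fun j _ hj => g j hj) (by simp) ?_ ?_ ?_
  · intro a _ ha b _ hb hab
    apply hy
    rw [← hg a ha, ← hg b hb, hab]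
  · intro j' _ hj'
    obtain ⟨j, hj⟩ : ∃ j, y j = x' j' := by
      obtain ⟨j, hj⟩ | ⟨k, hk⟩ : (∃ j, y j = x' j') ∨ ∃ k, y' k = x' j' := by
        simpa [Sum.exists] using (hy'.mem_iff (x' j')).1 (hx'.right_mem j')
      · exact ⟨j, hj⟩
      exfalso
      rcases eq_or_ne k i' with rfl | hki
      · exact hx'.ne i j' (hi'.symm.trans hk)
      · apply hj'
        rw [hμ.eq_zero (x := update y' i' (x' j')) hki, map_zero, mul_zero, mul_zero,
          toSemiring_zero]
        rw [update_of_ne hki, update_self, hk]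
    have hne : toSemiring (μ' (update y j (x i)) * ν' (update x i (y j))) ≠ 0 := by
      rwa [e1 j j' hj]
    refine ⟨j, Finset.mem_univ _, hne, hx'.right_injective ?_⟩
    rw [hg, hj]
  · intro j _ hne
    have hj := hg j hne
    exact e1 j _ hj.symm

end Dual

end Enumeration

/-! ### Counting entries in a subset, and fixing a block of entries -/

section Tail

variable {F α ι κ l κ' l' : Type*} [Tract F] [DecidableEq α]
variable [DecidableEq ι] [Fintype ι] [DecidableEq κ] [Fintype κ] [DecidableEq l] [Fintype l]
variable [DecidableEq κ'] [Fintype κ'] [DecidableEq l'] [Fintype l']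

/-- The number of entries of a tuple that lie in `A`. -/
def entryCount (A : Finset α) (z : ι → α) : ℕ := ∑ i, if z i ∈ A then 1 else 0

theorem entryCount_update (A : Finset α) (z : ι → α) (i : ι) (e : α) :
    entryCount A (update z i e) + (if z i ∈ A then 1 else 0) =
      entryCount A z + if e ∈ A then 1 else 0 := by
  unfold entryCount
  rw [← Finset.add_sum_erase _ _ (Finset.mem_univ i),
    ← Finset.add_sum_erase _ (fun j => if z j ∈ A then 1 else 0) (Finset.mem_univ i),
    Finset.sum_congr rfl (g := fun j => if z j ∈ A then 1 else 0) fun j hj => by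
      rw [update_of_ne (Finset.ne_of_mem_erase hj)], update_self]
  omega

theorem entryCount_eq_card (A : Finset α) (z : ι → α) :
    entryCount A z = (Finset.univ.filter fun i => z i ∈ A).card := by
  rw [entryCount, Finset.card_filter]

theorem entryCount_le (A : Finset α) (z : ι → α) : entryCount A z ≤ Fintype.card ι := by
  rw [entryCount_eq_card]
  exact Finset.card_le_univ _

theorem entryCount_comp (A : Finset α) (z : ι → α) (e : κ ≃ ι) :
    entryCount A (z ∘ e) = entryCount A z :=
  e.sum_comp fun i => if z i ∈ A then 1 else 0

theorem entryCount_sum_elim (A : Finset α) (x : κ → α) (y : l → α) :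
    entryCount A (Sum.elim x y) = entryCount A x + entryCount A y := by
  unfold entryCount
  rw [Fintype.sum_sum_type]
  rfl

theorem entryCount_of_forall_mem {A : Finset α} {z : ι → α} (h : ∀ i, z i ∈ A) :
    entryCount A z = Fintype.card ι := by
  simp [entryCount, h]

theorem entryCount_of_forall_notMem {A : Finset α} {z : ι → α} (h : ∀ i, z i ∉ A) :
    entryCount A z = 0 := by
  simp [entryCount, h]

theorem entryCount_tail {A : Finset α} {x : κ → α} {a : l → α} (hx : ∀ k, x k ∉ A)
    (ha : ∀ i, a i ∈ A) : entryCount A (Sum.elim x a) = Fintype.card l := by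
  rw [entryCount_sum_elim, entryCount_of_forall_mem ha, entryCount_of_forall_notMem hx, zero_add]

theorem entryCount_le_of_forall_mem_range {A : Finset α} {z : ι → α} {w : κ → α}
    (hw : Injective w) (h : ∀ p, w p ∈ A → ∃ q, z q = w p) :
    entryCount A w ≤ entryCount A z := by
  rw [entryCount_eq_card, entryCount_eq_card, ← Finset.card_image_of_injective _ hw]
  refine le_trans (Finset.card_le_card ?_) (Finset.card_image_le (f := z))
  intro e he
  obtain ⟨p, hp, rfl⟩ := Finset.mem_image.1 he
  have hp := (Finset.mem_filter.1 hp).2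
  obtain ⟨q, hq⟩ := h p hp
  exact Finset.mem_image.2 ⟨q, Finset.mem_filter.2 ⟨Finset.mem_univ _, hq ▸ hp⟩, hq⟩

theorem entryCount_of_isEnumeration {A E : Finset α} (hA : A ⊆ E) {z : ι → α}
    (hz : IsEnumeration E z) : entryCount A z = A.card := by
  rw [entryCount_eq_card, ← Finset.card_image_of_injective _ hz.injective]
  congr 1
  ext e
  simp only [Finset.mem_image, Finset.mem_filter, Finset.mem_univ, true_and]
  constructor
  · rintro ⟨i, hi, rfl⟩
    exact hi
  · intro he
    obtain ⟨i, rfl⟩ := (hz.mem_iff e).1 (hA he)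
    exact ⟨i, he, rfl⟩

/-- The entries of a tuple can be arranged such that those in `A` come last. -/
theorem exists_equiv_sum (A : Finset α) (z : ι → α)
    (hc : Fintype.card κ + Fintype.card l = Fintype.card ι)
    (hl : entryCount A z = Fintype.card l) :
    ∃ e : κ ⊕ l ≃ ι, (∀ k, z (e (Sum.inl k)) ∉ A) ∧ ∀ i, z (e (Sum.inr i)) ∈ A := by
  have h1 : Fintype.card l = Fintype.card {i // z i ∈ A} := by
    rw [Fintype.card_subtype, ← hl, entryCount_eq_card]
  have h2 : Fintype.card κ = Fintype.card {i // ¬ z i ∈ A} := by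
    rw [Fintype.card_subtype_compl, ← h1]
    omega
  obtain ⟨f⟩ := Fintype.card_eq.1 h1
  obtain ⟨g⟩ := Fintype.card_eq.1 h2
  refine ⟨(Equiv.sumCongr g f).trans ((Equiv.sumComm _ _).trans (Equiv.sumCompl _)),
    fun k => ?_, fun i => ?_⟩
  · simpa using (g k).2
  · simpa using (f i).2

/-- The leading term is nonzero, and a single nonzero term is never null, so some other summand is
nonzero. This is simultaneous basis exchange for the pair of underlying matroids. -/
theorem ExchangeRelations.exists_exchange {E : Finset α} {μ : (ι → α) → F} {ν : (κ → α) → F}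
    (h : ExchangeRelations E μ ν) (hμ : IsAlternating E μ) (hν : IsAlternating E ν) {x : ι → α}
    {y : κ → α} (hx : μ x ≠ 0) (hy : ν y ≠ 0) (i : ι) :
    ∃ j, ν (update y j (x i)) ≠ 0 ∧ μ (update x i (y j)) ≠ 0 := by
  by_contra! hn
  have := h x i y (hμ.mem_of_ne_zero hx) (hν.mem_of_ne_zero hy)
  unfold ExchangeAt at this
  rw [Finset.sum_eq_zero, add_zero, toSemiring_mem_iff] at this
  · exact mul_ne_zero eps_ne_zero (mul_ne_zero hy hx) this
  · intro j _
    by_cases hj : ν (update y j (x i)) = 0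
    · rw [hj, zero_mul, toSemiring_zero]
    · rw [hn j hj, mul_zero, toSemiring_zero]

/-- Some basis contains as many elements of `I` and as few elements of `J` as possible. -/
theorem exists_common_basis {E : Finset α} {φ : (ι → α) → F} (hφ : IsAlternating E φ)
    (he : ExchangeRelations E φ φ) (h0 : ∃ z, φ z ≠ 0) {I J : Finset α} (hIJ : Disjoint I J) :
    ∃ z, φ z ≠ 0 ∧ (∀ w, φ w ≠ 0 → entryCount I w ≤ entryCount I z) ∧
      ∀ w, φ w ≠ 0 → entryCount J z ≤ entryCount J w := by
  let N := Fintype.card ι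
  -- The weight N + 1 makes this lexicographic: first few entries in J, then many in I.
  let f : (ι → α) → ℕ := fun z => entryCount J z * (N + 1) + (N - entryCount I z)
  obtain ⟨z, hz, hmin⟩ := WellFounded.has_min (measure f).wf {z | φ z ≠ 0} h0
  have hmin : ∀ w, φ w ≠ 0 → f z ≤ f w := fun w hw => not_lt.1 (hmin w hw)
  have hJ : ∀ w, φ w ≠ 0 → entryCount J z ≤ entryCount J w := by
    intro w hw
    by_contra! hlt
    have h1 := hmin w hw
    have h2 : (entryCount J w + 1) * (N + 1) ≤ entryCount J z * (N + 1) :=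
      Nat.mul_le_mul_right _ hlt
    rw [add_mul, one_mul] at h2
    simp only [f] at h1
    omega
  refine ⟨z, hz, ?_, hJ⟩
  by_contra! hw
  -- Among the bases with more entries in I than z, take w closest to z. Exchanging an entry of w in
  -- I but not in z for z_j brings w closer to z if z_j is in I, and otherwise improves z with
  -- respect to J or I.
  let g : (ι → α) → ℕ := fun w => N - entryCount (Finset.univ.image z) w
  obtain ⟨w, ⟨hw, hwI⟩, hg⟩ := WellFounded.has_min (measure g).wf
    {w | φ w ≠ 0 ∧ entryCount I z < entryCount I w} hw
  have hg : ∀ v, φ v ≠ 0 → entryCount I z < entryCount I v → g w ≤ g v :=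
    fun v h1 h2 => not_lt.1 (hg v ⟨h1, h2⟩)
  obtain ⟨p, hp, hpz⟩ : ∃ p, w p ∈ I ∧ ∀ q, z q ≠ w p := by
    by_contra! hn
    exact absurd (entryCount_le_of_forall_mem_range (hφ.injective_of_ne_zero hw) hn)
      (not_le.2 hwI)
  have hpJ : w p ∉ J := Finset.disjoint_left.1 hIJ hp
  obtain ⟨j, hj1, hj2⟩ := he.exists_exchange hφ hφ hw hz p
  have c1 := entryCount_update I w p (z j)
  have c2 := entryCount_update (Finset.univ.image z) w p (z j)
  have c3 := entryCount_update I z j (w p)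
  have c4 := entryCount_update J z j (w p)
  have d1 := entryCount_le (Finset.univ.image z) (update w p (z j))
  have d2 := entryCount_le I (update z j (w p))
  have hzj : z j ∈ Finset.univ.image z := Finset.mem_image_of_mem _ (Finset.mem_univ _)
  have hwp : w p ∉ Finset.univ.image z := by simpa using hpz
  rw [if_pos hp] at c1 c3
  rw [if_neg hwp, if_pos hzj] at c2
  rw [if_neg hpJ] at c4
  by_cases hI : z j ∈ I
  · rw [if_pos hI] at c1
    have := hg _ hj2 (by omega)
    simp only [g] at this
    omega
  · rw [if_neg hI] at c3
    by_cases hJz : z j ∈ J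
    · rw [if_pos hJz] at c4
      have := hJ _ hj1
      omega
    · rw [if_neg hJz] at c4
      have := hmin _ hj1
      simp only [f, show entryCount J (update z j (w p)) = entryCount J z by omega] at this
      omega

/-- The number of elements of `A` in a basis is extremal if it equals `n`. -/
def IsExtremal (A : Finset α) (φ : (ι → α) → F) (n : ℕ) : Prop :=
  (∀ z, φ z ≠ 0 → entryCount A z ≤ n) ∨ ∀ z, φ z ≠ 0 → n ≤ entryCount A z

open Classical in
/-- The function `x ↦ φ (x, a)` on tuples in `S`, extended by zero. -/
def tailFunction (S : Finset α) (φ : (κ ⊕ l → α) → F) (a : l → α) : (κ → α) → F :=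
  fun x => if ∀ i, x i ∈ S then φ (Sum.elim x a) else 0

theorem tailFunction_apply {S : Finset α} {φ : (κ ⊕ l → α) → F} {a : l → α} {x : κ → α}
    (hx : ∀ i, x i ∈ S) : tailFunction S φ a x = φ (Sum.elim x a) := if_pos hx

theorem tailFunction_of_not_forall_mem {S : Finset α} {φ : (κ ⊕ l → α) → F} {a : l → α}
    {x : κ → α} (hx : ¬ ∀ i, x i ∈ S) : tailFunction S φ a x = 0 := if_neg hx

theorem mem_of_tailFunction_ne_zero {S : Finset α} {φ : (κ ⊕ l → α) → F} {a : l → α} {x : κ → α}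
    (hx : tailFunction S φ a x ≠ 0) : ∀ i, x i ∈ S := by
  by_contra h
  exact hx (tailFunction_of_not_forall_mem h)

theorem ne_zero_of_tailFunction_ne_zero {S : Finset α} {φ : (κ ⊕ l → α) → F} {a : l → α}
    {x : κ → α} (hx : tailFunction S φ a x ≠ 0) : φ (Sum.elim x a) ≠ 0 := by
  rwa [tailFunction_apply (mem_of_tailFunction_ne_zero hx)] at hx

theorem IsAlternating.tailFunction {E : Finset α} {φ : (κ ⊕ l → α) → F} (h : IsAlternating E φ)
    (S : Finset α) (a : l → α) : IsAlternating S (tailFunction S φ a) where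
  mem_of_ne_zero hx := mem_of_tailFunction_ne_zero hx
  injective_of_ne_zero hx :=
    (h.injective_of_ne_zero (ne_zero_of_tailFunction_ne_zero hx)).comp Sum.inl_injective
  comp_perm x σ := by
    by_cases hx : ∀ i, x i ∈ S
    · have : Sum.elim (x ∘ σ) a = Sum.elim x a ∘ Equiv.Perm.sumCongr σ 1 := by
        ext i
        cases i <;> rfl
      rw [tailFunction_apply hx, tailFunction_apply (x := x ∘ σ) fun i => hx (σ i), this, h.comp_perm,
        Equiv.Perm.sign_sumCongr, Equiv.Perm.sign_one, mul_one]
    · rw [tailFunction_of_not_forall_mem hx, tailFunction_of_not_forall_mem, mul_zero]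
      intro h'
      exact hx fun i => by simpa using h' (σ.symm i)

/-- Exchanging x_i outside A for an entry of b in A raises the A-count on the side of μ and lowers
it on the side of ν. Either bound kills these summands, and those left are the relation for the
remaining blocks. -/
theorem ExchangeRelations.tailFunction {E A : Finset α} {μ : (κ ⊕ l → α) → F}
    {ν : (κ' ⊕ l' → α) → F} (h : ExchangeRelations E μ ν) {a : l → α} {b : l' → α}
    (ha : ∀ i, a i ∈ A) (hb : ∀ i, b i ∈ A) (haE : ∀ i, a i ∈ E) (hbE : ∀ i, b i ∈ E)
    (hext : (∀ z, μ z ≠ 0 → entryCount A z ≤ Fintype.card l) ∨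
      ∀ z, ν z ≠ 0 → Fintype.card l' ≤ entryCount A z) :
    ExchangeRelations (E \ A) (tailFunction (E \ A) μ a) (tailFunction (E \ A) ν b) := by
  intro x i y hx hy
  have hxE : ∀ i, x i ∈ E := fun i => (Finset.mem_sdiff.1 (hx i)).1
  have hyE : ∀ i, y i ∈ E := fun i => (Finset.mem_sdiff.1 (hy i)).1
  have hxA : ∀ i, x i ∉ A := fun i => (Finset.mem_sdiff.1 (hx i)).2
  have hyA : ∀ i, y i ∉ A := fun i => (Finset.mem_sdiff.1 (hy i)).2
  have H := h (Sum.elim x a) (Sum.inl i) (Sum.elim y b) (Sum.rec hxE haE) (Sum.rec hyE hbE)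
  unfold ExchangeAt at H ⊢
  rw [Fintype.sum_sum_type] at H
  simp only [Sum.elim_inl, Sum.elim_inr] at H
  rw [Finset.sum_eq_zero (s := (Finset.univ : Finset l')), add_zero] at H
  · convert H using 2
    · rw [tailFunction_apply hx, tailFunction_apply hy]
    · refine Finset.sum_congr rfl fun j _ => ?_
      rw [tailFunction_apply, tailFunction_apply, Sum.update_elim_inl, Sum.update_elim_inl]
      · intro k; rw [update_apply]; split_ifs <;> simp only [hx, hy]
      · intro k; rw [update_apply]; split_ifs <;> simp only [hx, hy]
  · intro q _
    rcases hext with hext | hext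
    · have c := entryCount_update A (Sum.elim x a) (Sum.inl i) (b q)
      rw [entryCount_tail hxA ha, if_pos (hb q), Sum.elim_inl, if_neg (hxA i)] at c
      have : μ (update (Sum.elim x a) (Sum.inl i) (b q)) = 0 := by
        by_contra h0
        have := hext _ h0
        omega
      rw [this, mul_zero, toSemiring_zero]
    · have c := entryCount_update A (Sum.elim y b) (Sum.inr q) (x i)
      rw [entryCount_tail hyA hb, Sum.elim_inr, if_pos (hb q), if_neg (hxA i)] at c
      have : ν (update (Sum.elim y b) (Sum.inr q) (x i)) = 0 := by
        by_contra h0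
        have := hext _ h0
        omega
      rw [this, zero_mul, toSemiring_zero]

section Proportional

variable {E A : Finset α} {φ : (κ ⊕ l → α) → F}

/-- With pivot a_p against (x, a with e at p), summands crossing the boundary of A vanish by
extremality, and the others with q ≠ p repeat a_q. What remains is a two-term relation. -/
theorem ExchangeRelations.tail_mul_tail (he : ExchangeRelations E φ φ) (hφ : IsAlternating E φ)
    (hext : IsExtremal A φ (Fintype.card l)) {x x' : κ → α} {a : l → α} {p : l} {e : α}
    (hx : ∀ i, x i ∈ E \ A) (hx' : ∀ i, x' i ∈ E \ A) (ha : ∀ i, a i ∈ A) (haE : ∀ i, a i ∈ E)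
    (heA : e ∈ A) (heE : e ∈ E) :
    φ (Sum.elim x a) * φ (Sum.elim x' (update a p e)) =
      φ (Sum.elim x (update a p e)) * φ (Sum.elim x' a) := by
  have hxE : ∀ i, x i ∈ E := fun i => (Finset.mem_sdiff.1 (hx i)).1
  have hxA : ∀ i, x i ∉ A := fun i => (Finset.mem_sdiff.1 (hx i)).2
  have hx'E : ∀ i, x' i ∈ E := fun i => (Finset.mem_sdiff.1 (hx' i)).1
  have hx'A : ∀ i, x' i ∉ A := fun i => (Finset.mem_sdiff.1 (hx' i)).2
  have huA : ∀ i, update a p e i ∈ A := fun i => by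
    rw [update_apply]; split_ifs <;> simp only [ha, heA]
  have huE : ∀ i, update a p e i ∈ E := fun i => by
    rw [update_apply]; split_ifs <;> simp only [haE, heE]
  have H := he (Sum.elim x' a) (Sum.inr p) (Sum.elim x (update a p e)) (Sum.rec hx'E haE)
    (Sum.rec hxE huE)
  unfold ExchangeAt at H
  rw [Fintype.sum_sum_type, Finset.sum_eq_zero (s := (Finset.univ : Finset κ)), zero_add,
    Finset.sum_eq_single p, toSemiring_add_mem_iff, eps_mul_eps_mul] at H
  · simpa only [Sum.update_elim_inr, Sum.elim_inr, update_self, update_idem, update_eq_self]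
      using H
  · intro q _ hq
    rw [hφ.eq_zero (x := update (Sum.elim x' a) (Sum.inr p) _) (i := Sum.inr p) (j := Sum.inr q)
      (Sum.inr_injective.ne hq.symm), mul_zero, toSemiring_zero]
    rw [update_self, update_of_ne (Sum.inr_injective.ne hq), Sum.elim_inr, Sum.elim_inr,
      update_of_ne hq]
  · exact fun hp => absurd (Finset.mem_univ p) hp
  · intro k _
    have c1 := entryCount_update A (Sum.elim x (update a p e)) (Sum.inl k) (a p)
    have c2 := entryCount_update A (Sum.elim x' a) (Sum.inr p) (x k)
    rw [entryCount_tail hxA huA, Sum.elim_inl, if_neg (hxA k), if_pos (ha p)] at c1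
    rw [entryCount_tail hx'A ha, Sum.elim_inr, if_neg (hxA k), if_pos (ha p)] at c2
    simp only [Sum.elim_inl, Sum.elim_inr]
    rcases hext with hext | hext
    · have : φ (update (Sum.elim x (update a p e)) (Sum.inl k) (a p)) = 0 := by
        by_contra h0
        have := hext _ h0
        omega
      rw [this, zero_mul, toSemiring_zero]
    · have : φ (update (Sum.elim x' a) (Sum.inr p) (x k)) = 0 := by
        by_contra h0
        have := hext _ h0
        omega
      rw [this, mul_zero, toSemiring_zero]

/-- The functions `φ (·, a)` and `φ (·, a')` are proportional. -/
theorem ExchangeRelations.exists_tail_eq_mul (he : ExchangeRelations E φ φ)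
    (hφ : IsAlternating E φ) (hext : IsExtremal A φ (Fintype.card l)) {b b' : κ → α}
    {a a' : l → α} (hb : ∀ i, b i ∈ E \ A) (hb' : ∀ i, b' i ∈ E \ A) (ha : ∀ i, a i ∈ A)
    (ha' : ∀ i, a' i ∈ A) (h0 : φ (Sum.elim b a) ≠ 0) (h0' : φ (Sum.elim b' a') ≠ 0) :
    ∃ c : Fˣ, ∀ x : κ → α, (∀ i, x i ∈ E \ A) → φ (Sum.elim x a') = c * φ (Sum.elim x a) := by
  have hbA : ∀ i, b i ∉ A := fun i => (Finset.mem_sdiff.1 (hb i)).2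
  have hb'A : ∀ i, b' i ∉ A := fun i => (Finset.mem_sdiff.1 (hb' i)).2
  -- The measure is the number of entries of a that do not occur in a'. When it is zero, the two
  -- tails differ by a permutation.
  induction hn : Fintype.card l - entryCount (Finset.univ.image a') a using Nat.strong_induction_on
    generalizing a with
  | _ n ih =>
    have haE : ∀ i, a i ∈ E := fun i => hφ.mem_of_ne_zero h0 (Sum.inr i)
    have ha'E : ∀ i, a' i ∈ E := fun i => hφ.mem_of_ne_zero h0' (Sum.inr i)
    have hai : Injective a := (hφ.injective_of_ne_zero h0).comp Sum.inr_injective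
    have ha'i : Injective a' := (hφ.injective_of_ne_zero h0').comp Sum.inr_injective
    by_cases hsub : ∀ p, ∃ q, a' q = a p
    · choose f hf using hsub
      have hfi : Injective f := fun p q hpq => hai (by rw [← hf, ← hf, hpq])
      let σ : Equiv.Perm l := (Equiv.ofBijective f (Finite.injective_iff_bijective.1 hfi))
      refine ⟨Units.mk0 _ (ofSign_ne_zero (Equiv.Perm.sign σ)), fun x _ => ?_⟩
      have : Sum.elim x a = Sum.elim x a' ∘ Equiv.Perm.sumCongr 1 σ := by
        ext i
        rcases i with i | i
        · rfl
        · exact (hf i).symm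
      rw [this, hφ.comp_perm, Equiv.Perm.sign_sumCongr, Equiv.Perm.sign_one, one_mul,
        Units.val_mk0, ← mul_assoc, ofSign_mul_self, one_mul]
    · push Not at hsub
      obtain ⟨p, hp⟩ := hsub
      obtain ⟨j, hj1, hj2⟩ := he.exists_exchange hφ hφ h0 h0' (Sum.inr p)
      rw [Sum.elim_inr] at hj1
      rcases j with j | q
      -- A partner outside A would raise the A-count of one basis and lower that of the other,
      -- against extremality.
      · exfalso
        have c1 := entryCount_update A (Sum.elim b' a') (Sum.inl j) (a p)
        have c2 := entryCount_update A (Sum.elim b a) (Sum.inr p) (b' j)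
        rw [entryCount_tail hb'A ha', Sum.elim_inl, if_neg (hb'A j), if_pos (ha p)] at c1
        rw [entryCount_tail hbA ha, Sum.elim_inr, if_neg (hb'A j), if_pos (ha p)] at c2
        rcases hext with hext | hext
        · have := hext _ hj1
          omega
        · have := hext _ hj2
          simp only [Sum.elim_inl] at this
          omega
      · rw [Sum.elim_inr, Sum.update_elim_inr] at hj2
        have hdec := entryCount_update (Finset.univ.image a') a p (a' q)
        rw [if_neg (by simpa using hp),
          if_pos (Finset.mem_image_of_mem _ (Finset.mem_univ _))] at hdec
        have hle := entryCount_le (Finset.univ.image a') (update a p (a' q))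
        obtain ⟨c, hc⟩ := ih _ (by omega) (a := update a p (a' q))
          (fun i => by rw [update_apply]; split_ifs <;> simp only [ha, ha']) hj2 rfl
        refine ⟨c * (Units.mk0 _ hj2 * (Units.mk0 _ h0)⁻¹), fun x hx => ?_⟩
        have := he.tail_mul_tail hφ hext (p := p) hx hb ha haE (ha' q) (ha'E q)
        rw [hc x hx, Units.val_mul, mul_assoc]
        congr 1
        rw [Units.val_mul, Units.val_inv_eq_inv_val, Units.val_mk0, Units.val_mk0,
          mul_right_comm, eq_mul_inv_iff_mul_eq₀ h0, ← this, mul_comm]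

end Proportional

/-- The tail function of the dual is a dual of the tail function. -/
theorem IsDualWith.tailFunction {τ : TractHom F F} {E A : Finset α} (hA : A ⊆ E)
    {s : ((κ' ⊕ l') ⊕ (κ ⊕ l) → α) → F} {φ : (κ ⊕ l → α) → F} {ψ : (κ' ⊕ l' → α) → F}
    (h : IsDualWith τ E s φ ψ) {d : l' → α} {a : l → α}
    (hda : IsEnumeration A (Sum.elim d a)) :
    IsDualWith τ (E \ A)
      (fun z => s (Sum.elim z (Sum.elim d a) ∘ Equiv.sumSumSumComm κ' l' κ l))
      (tailFunction (E \ A) φ a) (tailFunction (E \ A) ψ d) where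
  apply x x' hx := by
    rw [tailFunction_apply hx.left_mem, tailFunction_apply hx.right_mem]
    have : Sum.elim (Sum.elim x x') (Sum.elim d a) ∘ Equiv.sumSumSumComm κ' l' κ l =
        Sum.elim (Sum.elim x d) (Sum.elim x' a) := by
      ext i
      rcases i with (i | i) | (i | i) <;> rfl
    rw [this]
    apply h.apply
    rw [← this]
    exact (hx.sum_elim hA hda).reindex _
  eq_zero x hx := by
    by_contra h0
    refine hx ⟨?_, mem_of_tailFunction_ne_zero h0⟩
    have h1 := ne_zero_of_tailFunction_ne_zero h0
    by_contra hn
    refine h1 (h.eq_zero _ fun hh => hn (hh.1.comp Sum.inl_injective))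

end Tail

/-! ### The sorting sign as orientation, and tuples indexed by `Fin` -/

section Sorting

variable {F α : Type*} [Tract F] [LinearOrder α]

/-- An injective tuple has a unique increasing rearrangement, so sorting z ∘ σ and then applying σ
is sorting z. -/
theorem isOrientation_sort (E : Finset α) (n : ℕ) :
    IsOrientation E (fun z : Fin n → α => ofSign F (Equiv.Perm.sign (Tuple.sort z))) where
  ne_zero _ := ofSign_ne_zero _
  comp_perm {z} hz σ := by
    have h : z ∘ (σ * Tuple.sort (z ∘ σ)) = z ∘ Tuple.sort z :=
      Tuple.unique_monotone (Tuple.monotone_sort (z ∘ σ)) (Tuple.monotone_sort z)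
    have h : σ * Tuple.sort (z ∘ σ) = Tuple.sort z := by
      ext i
      exact congrArg Fin.val (hz.injective (congrFun h i))
    rw [← h, Equiv.Perm.sign_mul, ← ofSign_mul, ← mul_assoc, Int.units_mul_self, one_mul]

theorem exists_isOrientation (F : Type*) [Tract F] (E : Finset α) (ω : Type*) [DecidableEq ω]
    [Fintype ω] : ∃ s : (ω → α) → F, IsOrientation E s :=
  ⟨_, (isOrientation_sort E (Fintype.card ω)).reindex (Fintype.equivFin ω).symm⟩

end Sorting

section FinSum

variable {F α : Type*} [Tract F] {r k l : ℕ}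

/-- The decomposition of the index set of a tuple of length `r = k + l`. -/
def finSum (h : r = k + l) : Fin r ≃ Fin k ⊕ Fin l := (finCongr h).trans finSumFinEquiv.symm

theorem append_cast_eq (h : r = k + l) (x : Fin k → α) (a : Fin l → α) :
    (fun i => Fin.append x a (Fin.cast h i)) = Sum.elim x a ∘ finSum h := by
  subst h
  ext i
  refine Fin.addCases (fun i => ?_) (fun i => ?_) i <;> simp [finSum]

theorem append_eq (x : Fin k → α) (a : Fin l → α) :
    Fin.append x a = Sum.elim x a ∘ finSum rfl := append_cast_eq rfl x a

theorem fixTail_eq [DecidableEq α] (S : Finset α) (h : r = k + l) (φ : (Fin r → α) → F) (a : Fin l → α) :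
    FMatroidData.fixTail S h φ a = tailFunction S (fun z => φ (z ∘ finSum h)) a := by
  ext x
  simp only [FMatroidData.fixTail, tailFunction, append_cast_eq]

end FinSum

theorem IsDualWith.reindex {F α ι κ ι' κ' : Type*} [Tract F] {τ : TractHom F F} {E : Finset α}
    {s : (κ ⊕ ι → α) → F} {φ : (ι → α) → F} {ψ : (κ → α) → F}
    (h : IsDualWith τ E s φ ψ) (e : κ ≃ κ') (e' : ι ≃ ι') :
    IsDualWith τ E (fun z => s (z ∘ Equiv.sumCongr e e')) (fun x => φ (x ∘ e'))
      (fun x => ψ (x ∘ e)) where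
  apply x x' hx := by
    have : Sum.elim x x' ∘ Equiv.sumCongr e e' = Sum.elim (x ∘ e) (x' ∘ e') := by
      ext i
      cases i <;> rfl
    simp only [this]
    exact h.apply _ _ (this ▸ hx.reindex _)
  eq_zero x hx := by
    refine h.eq_zero _ fun hh => hx ⟨?_, fun i => by simpa using hh.2 (e.symm i)⟩
    exact (Injective.of_comp_iff' _ e.bijective).1 hh.1

theorem IsAlternating.map {F F' α ι : Type*} [Tract F] [Tract F'] [DecidableEq ι] [Fintype ι]
    {E : Finset α} {φ : (ι → α) → F} (h : IsAlternating E φ) (f : TractHom F F') :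
    IsAlternating E (fun x => f.toMonoidWithZeroHom (φ x)) where
  mem_of_ne_zero {x} hx := h.mem_of_ne_zero fun h0 => hx (by rw [h0, map_zero])
  injective_of_ne_zero {x} hx := h.injective_of_ne_zero fun h0 => hx (by rw [h0, map_zero])
  comp_perm x σ := by rw [h.comp_perm, map_mul, f.map_ofSign]

theorem entryCount_sdiff_add {α ι : Type*} [DecidableEq α] [Fintype ι] (A : Finset α)
    {E : Finset α} {z : ι → α} (hz : ∀ i, z i ∈ E) :
    entryCount (E \ A) z + entryCount A z = Fintype.card ι := by
  unfold entryCount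
  rw [← Finset.sum_add_distrib, ← Finset.card_univ, Finset.card_eq_sum_ones]
  refine Finset.sum_congr rfl fun i _ => ?_
  by_cases h : z i ∈ A <;> simp [h, hz i]

/-! ### Classes of functions, and push-forwards -/

namespace FMatroidData

variable {F F' α : Type*} [Tract F] [Tract F']

/-- The class `[φ]`. -/
def ofFunction (E : Finset α) (r : ℕ) (φ : (Fin r → α) → F) : FMatroidData F α where
  ground := E
  rank := r
  reps := {ψ | ∃ c : Fˣ, ∀ x, ψ x = (c : F) * φ x}

theorem isFMatroid_ofFunction {E : Finset α} {r : ℕ} {φ : (Fin r → α) → F}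
    (h : IsGrassmannPlucker E r φ) : (ofFunction E r φ).IsFMatroid := ⟨φ, h, rfl⟩

/-- With the rank as a free variable instead of a structure field, ranks and representatives can be
substituted without transport along equalities. -/
theorem IsFMatroid.exists_eq {M : FMatroidData F α} (h : M.IsFMatroid) :
    ∃ (E : Finset α) (r : ℕ) (φ : (Fin r → α) → F),
      IsGrassmannPlucker E r φ ∧ M = ofFunction E r φ := by
  obtain ⟨E, r, R⟩ := M
  obtain ⟨φ, hφ, hR⟩ := h
  refine ⟨E, r, φ, hφ, ?_⟩
  dsimp only at hR
  rw [hR, ofFunction]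

theorem ofFunction_eq_of_reps {E : Finset α} {r : ℕ} {φ : (Fin r → α) → F}
    {R : Set ((Fin r → α) → F)} (h : ∀ ψ, ψ ∈ R ↔ ∃ c : Fˣ, ∀ x, ψ x = (c : F) * φ x) :
    (⟨E, r, R⟩ : FMatroidData F α) = ofFunction E r φ := by
  rw [ofFunction]
  congr 1
  ext ψ
  exact h ψ

theorem ofFunction_congr {E : Finset α} {r : ℕ} {φ φ' : (Fin r → α) → F} (u : Fˣ)
    (h : ∀ x, φ' x = u * φ x) : ofFunction E r φ' = ofFunction E r φ := by
  refine ofFunction_eq_of_reps fun ψ => ⟨?_, ?_⟩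
  · rintro ⟨c, hc⟩
    exact ⟨c * u, fun x => by rw [hc, h, Units.val_mul, mul_assoc]⟩
  · rintro ⟨c, hc⟩
    refine ⟨c * u⁻¹, fun x => ?_⟩
    rw [hc, h, ← mul_assoc, ← Units.val_mul, inv_mul_cancel_right]

theorem isQuotientOf_ofFunction_iff {E : Finset α} {r w : ℕ} {μ : (Fin r → α) → F}
    {ν : (Fin w → α) → F} (hμ : IsAlternating E μ) (hν : IsAlternating E ν) :
    (ofFunction E r μ).IsQuotientOf (ofFunction E w ν) ↔ ExchangeRelations E μ ν := by
  constructor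
  · intro h
    exact (flagRelations_iff hμ hν).1 (h μ ⟨1, by simp⟩ ν ⟨1, by simp⟩)
  · rintro h μ' ⟨c, hc⟩ ν' ⟨d, hd⟩
    obtain rfl : μ' = fun x => (c : F) * μ x := funext hc
    obtain rfl : ν' = fun x => (d : F) * ν x := funext hd
    exact (flagRelations_iff (hμ.smul _) (hν.smul _)).2 (h.smul c d)

theorem isBasisTuple_ofFunction {E : Finset α} {r : ℕ} {φ : (Fin r → α) → F} {x : Fin r → α} :
    (ofFunction E r φ).IsBasisTuple x ↔ φ x ≠ 0 := by
  constructor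
  · rintro ⟨φ', ⟨c, hc⟩, h⟩
    rw [hc] at h
    exact right_ne_zero_of_mul h
  · intro h
    exact ⟨φ, ⟨1, by simp⟩, h⟩

section Push

theorem push_ofFunction (f : TractHom F F') (E : Finset α) {r : ℕ} (φ : (Fin r → α) → F) :
    (ofFunction E r φ).push f = ofFunction E r fun x => f.toMonoidWithZeroHom (φ x) := by
  have key : ∀ ψ : (Fin r → α) → F', (∃ φ' : (Fin r → α) → F,
      (∃ c : Fˣ, ∀ x, φ' x = c * φ x) ∧
        ∃ c : F'ˣ, ∀ x, ψ x = c * f.toMonoidWithZeroHom (φ' x)) ↔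
      ∃ c : F'ˣ, ∀ x, ψ x = c * f.toMonoidWithZeroHom (φ x) := by
    refine fun ψ => ⟨?_, fun ⟨c, hc⟩ => ⟨φ, ⟨1, by simp⟩, c, hc⟩⟩
    rintro ⟨φ', ⟨c, hc⟩, d, hd⟩
    refine ⟨d * Units.map (f.toMonoidWithZeroHom : F →* F') c, fun x => ?_⟩
    rw [hd, hc, map_mul, Units.val_mul, mul_assoc]
    rfl
  exact ofFunction_eq_of_reps key

theorem IsFMatroid.push {M : FMatroidData F α} (h : M.IsFMatroid) (f : TractHom F F') :
    (M.push f).IsFMatroid := by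
  obtain ⟨E, r, φ, hφ, rfl⟩ := h.exists_eq
  rw [push_ofFunction]
  obtain ⟨ha, ⟨x, hx⟩, he⟩ := isGrassmannPlucker_iff.1 hφ
  exact isFMatroid_ofFunction (isGrassmannPlucker_iff.2
    ⟨ha.map f, ⟨x, f.map_ne_zero hx⟩, he.map f⟩)

theorem IsQuotientOf.push {M N : FMatroidData F α} (h : M.IsQuotientOf N) (hM : M.IsFMatroid)
    (hN : N.IsFMatroid) (hE : M.ground = N.ground) (f : TractHom F F') :
    (M.push f).IsQuotientOf (N.push f) := by
  obtain ⟨E, r, μ, hμ, rfl⟩ := hM.exists_eq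
  obtain ⟨E', w, ν, hν, rfl⟩ := hN.exists_eq
  obtain rfl : E = E' := hE
  have aμ := (isGrassmannPlucker_iff.1 hμ).1
  have aν := (isGrassmannPlucker_iff.1 hν).1
  rw [isQuotientOf_ofFunction_iff aμ aν] at h
  rw [push_ofFunction, push_ofFunction, isQuotientOf_ofFunction_iff (aμ.map f) (aν.map f)]
  exact h.map f

end Push

/-! ### Duality of F-matroids -/

section Dual

variable [LinearOrder α]

theorem isDualFunction_iff {τ : TractHom F F} {E : Finset α} {r : ℕ} (hr : E.card - r + r = E.card)
    {φ : (Fin r → α) → F} {ψ : (Fin (E.card - r) → α) → F} :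
    IsDualFunction τ E φ ψ ↔ IsDualWith τ E
      (fun z => ofSign F (Equiv.Perm.sign (Tuple.sort (z ∘ finSumFinEquiv.symm)))) φ ψ := by
  have key : ∀ x x', Finset.univ.image (Fin.append x x') = E ↔
      IsEnumeration E (Sum.elim x x' : Fin (E.card - r) ⊕ Fin r → α) := by
    intro x x'
    constructor
    · intro h
      have hinj : Injective (Fin.append x x') := by
        rw [← Set.injOn_univ, ← Finset.coe_univ, ← Finset.card_image_iff, h, Finset.card_univ,
          Fintype.card_fin, hr]
      have hz : IsEnumeration E (Fin.append x x') := ⟨hinj, fun e => by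
        simpa using (Finset.ext_iff.1 h e).symm⟩
      have hxx : Sum.elim x x' = Fin.append x x' ∘ finSumFinEquiv := by
        ext i
        cases i <;> simp
      rw [hxx]
      exact hz.reindex _
    · intro h
      ext e
      rw [append_eq, (h.reindex (finSum rfl)).mem_iff]
      simp
  constructor
  · rintro ⟨h1, h2⟩
    refine ⟨fun x x' hx => ?_, h2⟩
    rw [h1 x x' ((key x x').2 hx), append_eq]
    rfl
  · rintro ⟨h1, h2⟩
    refine ⟨fun x x' hx => ?_, h2⟩
    rw [h1 x x' ((key x x').1 hx), append_eq]
    rfl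

/-- The sorting sign may be replaced by any orientation, since the two differ by a unit and only the
class matters. -/
theorem dual_ofFunction {τ : TractHom F F} (hτ : τ.IsInvolution) {E : Finset α} {r k : ℕ}
    (h : k + r = E.card) {φ : (Fin r → α) → F} {ψ : (Fin k → α) → F}
    {s : (Fin k ⊕ Fin r → α) → F} (hs : IsOrientation E s) (hψ : IsDualWith τ E s φ ψ) :
    (ofFunction E r φ).dual τ = ofFunction E k ψ := by
  obtain rfl : k = E.card - r := by omega
  obtain ⟨u, hu⟩ := hs.exists_eq_mul ((isOrientation_sort (F := F) E _).reindex finSumFinEquiv.symm)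
  suffices key : ∀ ψ' : (Fin (E.card - r) → α) → F, (∃ φ' : (Fin r → α) → F,
      (∃ c : Fˣ, ∀ x, φ' x = c * φ x) ∧ IsDualFunction τ E φ' ψ') ↔
        ∃ c : Fˣ, ∀ x, ψ' x = c * ψ x from ofFunction_eq_of_reps key
  refine fun ψ' => ⟨?_, ?_⟩
  · rintro ⟨φ', ⟨c, hc⟩, hd⟩
    have hd := (isDualFunction_iff h).1 hd
    refine ⟨u * Units.map (τ.toMonoidWithZeroHom : F →* F) c, fun x => ?_⟩
    by_cases hx : Injective x ∧ ∀ i, x i ∈ E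
    · obtain ⟨x', hx'⟩ := exists_isEnumeration (ι := Fin r) (by simpa using h) hx.1 hx.2
      rw [hd.apply x x' hx', hψ.apply x x' hx', hu _ hx', hc, map_mul, Units.val_mul,
        Units.coe_map, mul_mul_mul_comm]
      rfl
    · rw [hd.eq_zero x hx, hψ.eq_zero x hx, mul_zero]
  · rintro ⟨c, hc⟩
    -- The dual applies τ to the scalar, so the scalar is chosen as τ(u⁻¹ c); applying the
    -- involution once more returns u⁻¹ c.
    refine ⟨_, ⟨Units.map (τ.toMonoidWithZeroHom : F →* F) (u⁻¹ * c), fun x => rfl⟩,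
      (isDualFunction_iff h).2 ⟨fun x x' hx => ?_, fun x hx => ?_⟩⟩
    · have h1 := hu _ hx
      rw [h1, map_mul, Units.coe_map, hc, hψ.apply x x' hx]
      change _ = _ * (τ.toMonoidWithZeroHom (τ.toMonoidWithZeroHom _) * _)
      rw [hτ, mul_mul_mul_comm, ← Units.val_mul, mul_inv_cancel_left]
    · rw [hc, hψ.eq_zero x hx, mul_zero]

theorem _root_.IsGrassmannPlucker.rank_le {E : Finset α} {r : ℕ} {φ : (Fin r → α) → F}
    (h : IsGrassmannPlucker E r φ) : r ≤ E.card := by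
  obtain ⟨ha, ⟨x, hx⟩, -⟩ := isGrassmannPlucker_iff.1 h
  rw [← Fintype.card_fin r, ← Finset.card_univ,
    ← Finset.card_image_of_injective _ (ha.injective_of_ne_zero hx)]
  refine Finset.card_le_card fun e he => ?_
  obtain ⟨i, -, rfl⟩ := Finset.mem_image.1 he
  exact ha.mem_of_ne_zero hx i

theorem exists_dual_eq {τ : TractHom F F} (hτ : τ.IsInvolution) {E : Finset α} {r : ℕ}
    {φ : (Fin r → α) → F} (h : IsGrassmannPlucker E r φ) :
    ∃ (k : ℕ) (ψ : (Fin k → α) → F) (s : (Fin k ⊕ Fin r → α) → F), k + r = E.card ∧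
      IsOrientation E s ∧ IsDualWith τ E s φ ψ ∧ (ofFunction E r φ).dual τ = ofFunction E k ψ := by
  have hr := Nat.sub_add_cancel h.rank_le
  obtain ⟨s, hs⟩ := exists_isOrientation F E (Fin (E.card - r) ⊕ Fin r)
  obtain ⟨ψ, hψ⟩ := exists_isDualWith τ hs (isGrassmannPlucker_iff.1 h).1
  exact ⟨_, ψ, s, hr, hs, hψ, dual_ofFunction hτ hr hs hψ⟩

theorem IsFMatroid.dual {τ : TractHom F F} (hτ : τ.IsInvolution) {M : FMatroidData F α}
    (h : M.IsFMatroid) : (M.dual τ).IsFMatroid := by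
  obtain ⟨E, r, φ, hφ, rfl⟩ := h.exists_eq
  obtain ⟨k, ψ, s, hk, hs, hψ, hd⟩ := exists_dual_eq hτ hφ
  obtain ⟨ha, h0, he⟩ := isGrassmannPlucker_iff.1 hφ
  have hc : Fintype.card (Fin k) + Fintype.card (Fin r) = E.card := by simpa using hk
  rw [hd]
  exact isFMatroid_ofFunction (isGrassmannPlucker_iff.2
    ⟨hψ.isAlternating hs hc, hψ.exists_ne_zero hs hc ha h0, he.dual ha hs hs hψ hψ hc hc⟩)

theorem IsQuotientOf.dual {τ : TractHom F F} (hτ : τ.IsInvolution) {M N : FMatroidData F α}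
    (h : M.IsQuotientOf N) (hM : M.IsFMatroid) (hN : N.IsFMatroid) (hE : M.ground = N.ground) :
    (N.dual τ).IsQuotientOf (M.dual τ) := by
  obtain ⟨E, r, μ, hμ, rfl⟩ := hM.exists_eq
  obtain ⟨E', w, ν, hν, rfl⟩ := hN.exists_eq
  obtain rfl : E = E' := hE
  have aμ := (isGrassmannPlucker_iff.1 hμ).1
  have aν := (isGrassmannPlucker_iff.1 hν).1
  rw [isQuotientOf_ofFunction_iff aμ aν] at h
  obtain ⟨k, μ', s, hk, hs, hμ', hd⟩ := exists_dual_eq hτ hμ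
  obtain ⟨k', ν', t, hk', ht, hν', hd'⟩ := exists_dual_eq hτ hν
  have hc : Fintype.card (Fin k) + Fintype.card (Fin r) = E.card := by simpa using hk
  have hc' : Fintype.card (Fin k') + Fintype.card (Fin w) = E.card := by simpa using hk'
  rw [hd, hd', isQuotientOf_ofFunction_iff (hν'.isAlternating ht hc') (hμ'.isAlternating hs hc)]
  exact h.dual aμ hs ht hμ' hν' hc hc'

theorem IsFMatroid.dual_dual {τ : TractHom F F} (hτ : τ.IsInvolution) {M : FMatroidData F α}
    (h : M.IsFMatroid) : (M.dual τ).dual τ = M := by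
  obtain ⟨E, r, φ, hφ, rfl⟩ := h.exists_eq
  obtain ⟨k, ψ, s, hk, hs, hψ, hd⟩ := exists_dual_eq hτ hφ
  rw [hd]
  exact dual_ofFunction hτ (by omega) ((hs.reindex (Equiv.sumComm _ _)).map_inv τ)
    (hψ.symm hs hτ (isGrassmannPlucker_iff.1 hφ).1)

end Dual

end FMatroidData

/-! ### Contraction and deletion as classes of a single function -/

section Split

variable {F α : Type*} [Tract F] [DecidableEq α]

/-- `(b, a)` is a basis such that exactly the entries of `a` lie in `A`. -/
structure IsSplitBasis {κ l : Type*} (E A : Finset α) (φ : (κ ⊕ l → α) → F) (b : κ → α)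
    (a : l → α) : Prop where
  left_mem : ∀ i, b i ∈ E \ A
  right_mem : ∀ i, a i ∈ A
  ne_zero : φ (Sum.elim b a) ≠ 0

theorem IsSplitBasis.tailFunction_ne_zero {κ l : Type*} [DecidableEq κ] [Fintype κ]
    [DecidableEq l] [Fintype l] {E A : Finset α} {φ : (κ ⊕ l → α) → F}
    {b : κ → α} {a : l → α} (h : IsSplitBasis E A φ b a) : tailFunction (E \ A) φ a b ≠ 0 := by
  rw [tailFunction_apply h.left_mem]
  exact h.ne_zero

variable {E A : Finset α} {r k l : ℕ} {φ : (Fin r → α) → F}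

theorem exists_isSplitBasis (hφ : IsAlternating E φ) (h : r = k + l) {z : Fin r → α}
    (hz : φ z ≠ 0) (hl : entryCount A z = l) :
    ∃ b a, IsSplitBasis E A (fun x => φ (x ∘ finSum h)) b a := by
  obtain ⟨e, h1, h2⟩ := exists_equiv_sum (κ := Fin k) (l := Fin l) A z (by simp [h])
    (by simpa using hl)
  refine ⟨fun i => z (e (Sum.inl i)), fun i => z (e (Sum.inr i)), ?_, h2, ?_⟩
  · exact fun i => Finset.mem_sdiff.2 ⟨hφ.mem_of_ne_zero hz _, h1 i⟩
  · have : Sum.elim (fun i => z (e (Sum.inl i))) (fun i => z (e (Sum.inr i))) ∘ finSum h =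
        z ∘ (((finSum h).trans e : Equiv.Perm (Fin r))) := by
      ext i
      simp only [comp_apply, Equiv.trans_apply]
      cases finSum h i <;> rfl
    rw [this]
    exact (hφ.comp_perm_ne_zero _).2 hz

theorem isGrassmannPlucker_tailFunction (hφ : IsGrassmannPlucker E r φ) (h : r = k + l)
    {b : Fin k → α} {a : Fin l → α} (hba : IsSplitBasis E A (fun x => φ (x ∘ finSum h)) b a)
    (hext : IsExtremal A φ l) :
    IsGrassmannPlucker (E \ A) k (tailFunction (E \ A) (fun x => φ (x ∘ finSum h)) a) := by
  obtain ⟨ha, -, he⟩ := isGrassmannPlucker_iff.1 hφ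
  have haE : ∀ i, a i ∈ E := fun i => (ha.reindex (finSum h)).mem_of_ne_zero hba.ne_zero (Sum.inr i)
  refine isGrassmannPlucker_iff.2 ⟨(ha.reindex _).tailFunction _ _,
    ⟨b, hba.tailFunction_ne_zero⟩, (he.reindex _ _).tailFunction hba.right_mem hba.right_mem
      haE haE ?_⟩
  rw [Fintype.card_fin]
  refine hext.imp (fun hm z hz => ?_) (fun hm z hz => ?_)
  · rw [← entryCount_comp A z (finSum h)]
    exact hm _ hz
  · rw [← entryCount_comp A z (finSum h)]
    exact hm _ hz

theorem exists_tailFunction_eq_mul (hφ : IsGrassmannPlucker E r φ) (h : r = k + l)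
    {b b' : Fin k → α} {a a' : Fin l → α}
    (hba : IsSplitBasis E A (fun x => φ (x ∘ finSum h)) b a)
    (hba' : IsSplitBasis E A (fun x => φ (x ∘ finSum h)) b' a') (hext : IsExtremal A φ l) :
    ∃ c : Fˣ, ∀ x, tailFunction (E \ A) (fun x => φ (x ∘ finSum h)) a' x =
      c * tailFunction (E \ A) (fun x => φ (x ∘ finSum h)) a x := by
  obtain ⟨ha, -, he⟩ := isGrassmannPlucker_iff.1 hφ
  obtain ⟨c, hc⟩ := (he.reindex (finSum h) (finSum h)).exists_tail_eq_mul (ha.reindex _) (A := A)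
    (by
      rw [Fintype.card_fin]
      refine hext.imp (fun hm z hz => ?_) (fun hm z hz => ?_)
      · rw [← entryCount_comp A z (finSum h)]
        exact hm _ hz
      · rw [← entryCount_comp A z (finSum h)]
        exact hm _ hz)
    hba.left_mem hba'.left_mem hba.right_mem hba'.right_mem hba.ne_zero hba'.ne_zero
  refine ⟨c, fun x => ?_⟩
  by_cases hx : ∀ i, x i ∈ E \ A
  · rw [tailFunction_apply hx, tailFunction_apply hx]
    exact hc x hx
  · rw [tailFunction_of_not_forall_mem hx, tailFunction_of_not_forall_mem hx, mul_zero]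

theorem tailFunction_smul (S : Finset α) {κ l : Type*} [DecidableEq κ] [Fintype κ]
    [DecidableEq l] [Fintype l] (φ : (κ ⊕ l → α) → F) (a : l → α) (c : F)
    (x : κ → α) : tailFunction S (fun z => c * φ z) a x = c * tailFunction S φ a x := by
  simp only [tailFunction, mul_ite, mul_zero]

end Split

namespace FMatroidData

variable {F α : Type*} [Tract F] [DecidableEq α] {E A : Finset α} {r k l : ℕ}
  {φ : (Fin r → α) → F}

theorem indep_ofFunction {B : Finset α} :
    (ofFunction E r φ).Indep B ↔ ∃ z : Fin r → α, φ z ≠ 0 ∧ ∀ e ∈ B, ∃ i, z i = e :=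
  exists_congr fun _ => and_congr_left fun _ => isBasisTuple_ofFunction

theorem entryCount_le_rk (hφ : IsAlternating E φ) {z : Fin r → α} (hz : φ z ≠ 0) :
    entryCount A z ≤ (ofFunction E r φ).rk A := by
  classical
  rw [entryCount_eq_card, ← Finset.card_image_of_injective _ (hφ.injective_of_ne_zero hz)]
  refine Finset.le_sup (f := Finset.card) (Finset.mem_filter.2 ⟨Finset.mem_powerset.2 ?_,
    indep_ofFunction.2 ⟨z, hz, ?_⟩⟩)
  · intro e he
    obtain ⟨i, hi, rfl⟩ := Finset.mem_image.1 he
    exact (Finset.mem_filter.1 hi).2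
  · intro e he
    obtain ⟨i, hi, rfl⟩ := Finset.mem_image.1 he
    exact ⟨i, rfl⟩

theorem rk_le_of_entryCount_le {n : ℕ} (h : ∀ z, φ z ≠ 0 → entryCount A z ≤ n) :
    (ofFunction E r φ).rk A ≤ n := by
  classical
  refine Finset.sup_le fun B hB => ?_
  obtain ⟨hBA, hB⟩ := Finset.mem_filter.1 hB
  obtain ⟨z, hz, hBz⟩ := indep_ofFunction.1 hB
  refine le_trans ?_ (h z hz)
  rw [entryCount_eq_card]
  refine le_trans (Finset.card_le_card ?_) (Finset.card_image_le (f := z))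
  intro e he
  obtain ⟨i, rfl⟩ := hBz e he
  exact Finset.mem_image.2
    ⟨i, Finset.mem_filter.2 ⟨Finset.mem_univ _, Finset.mem_powerset.1 hBA he⟩, rfl⟩

theorem rk_eq (hφ : IsAlternating E φ) {z : Fin r → α} (hz : φ z ≠ 0)
    (h : ∀ w, φ w ≠ 0 → entryCount A w ≤ entryCount A z) :
    (ofFunction E r φ).rk A = entryCount A z :=
  le_antisymm (rk_le_of_entryCount_le h) (entryCount_le_rk hφ hz)

theorem contract_ofFunction (hφ : IsGrassmannPlucker E r φ) (h : r = k + l) {b : Fin k → α}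
    {a : Fin l → α} (hba : IsSplitBasis E A (fun x => φ (x ∘ finSum h)) b a)
    (hmax : ∀ z, φ z ≠ 0 → entryCount A z ≤ l) :
    (ofFunction E r φ).contract A =
      ofFunction (E \ A) k (tailFunction (E \ A) (fun x => φ (x ∘ finSum h)) a) := by
  have ha := (isGrassmannPlucker_iff.1 hφ).1
  have hbA : ∀ i, b i ∉ A := fun i => (Finset.mem_sdiff.1 (hba.left_mem i)).2
  have hrk : (ofFunction E r φ).rk A = l := by
    have hc : entryCount A (Sum.elim b a ∘ finSum h) = l := by
      rw [entryCount_comp, entryCount_tail hbA hba.right_mem, Fintype.card_fin]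
    rw [← hc]
    exact rk_eq ha hba.ne_zero (by rwa [hc])
  have hai : Injective a :=
    ((ha.reindex _).injective_of_ne_zero hba.ne_zero).comp Sum.inr_injective
  -- The ranks in the definition are built from `rk`, so l and k must become these expressions for
  -- the types to agree.
  subst hrk
  obtain rfl : k = r - (ofFunction E r φ).rk A := by omega
  suffices key : ∀ ψ : (Fin (r - (ofFunction E r φ).rk A) → α) → F,
      (∃ φ' : (Fin r → α) → F, (∃ c : Fˣ, ∀ x, φ' x = c * φ x) ∧
        ∃ a : Fin ((ofFunction E r φ).rk A) → α, Function.Injective a ∧ (∀ i, a i ∈ A) ∧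
          (ofFunction E r φ).Indep (Finset.univ.image a) ∧ ψ = fixTail (E \ A) h φ' a) ↔
      ∃ c : Fˣ, ∀ x, ψ x = c * tailFunction (E \ A) (fun x => φ (x ∘ finSum h)) a x from
    ofFunction_eq_of_reps key
  refine fun ψ => ⟨?_, ?_⟩
  · rintro ⟨φ', ⟨c, hc⟩, a', hi', hA', hind, rfl⟩
    obtain ⟨z, hz, haz⟩ := indep_ofFunction.1 hind
    obtain rfl : φ' = fun x => (c : F) * φ x := funext hc
    have haz : ∀ p, ∃ i, z i = a' p := fun p =>
      haz _ (Finset.mem_image_of_mem _ (Finset.mem_univ p))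
    choose f hf using haz
    have hfi : Injective f := fun p q hpq => hi' (by rw [← hf, ← hf, hpq])
    obtain ⟨g, hg⟩ := exists_isEnumeration_left (κ := Fin (r - (ofFunction E r φ).rk A))
      (E := (Finset.univ : Finset (Fin r))) (by simpa using h.symm) hfi (by simp)
    let e : Fin (r - (ofFunction E r φ).rk A) ⊕ Fin ((ofFunction E r φ).rk A) ≃ Fin r :=
      Equiv.ofBijective (Sum.elim g f) ⟨hg.injective, fun i => (hg.mem_iff i).1 (by simp)⟩
    have hz' : φ (Sum.elim (z ∘ g) a' ∘ finSum h) ≠ 0 := by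
      have : Sum.elim (z ∘ g) a' ∘ finSum h = z ∘ ((finSum h).trans e : Equiv.Perm (Fin r)) := by
        ext i
        simp only [comp_apply, Equiv.trans_apply]
        cases finSum h i
        · rfl
        · exact (hf _).symm
      rw [this]
      exact (ha.comp_perm_ne_zero _).2 hz
    -- The tail a' already attains the maximal A-count, so the entries completing it to a basis lie
    -- outside A.
    have hcount := hmax _ hz'
    rw [entryCount_comp, entryCount_sum_elim, entryCount_of_forall_mem hA', Fintype.card_fin,
      entryCount] at hcount
    have hba' : IsSplitBasis E A (fun x => φ (x ∘ finSum h)) (z ∘ g) a' := by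
      refine ⟨fun i => Finset.mem_sdiff.2 ⟨ha.mem_of_ne_zero hz _, fun hi => ?_⟩, hA', hz'⟩
      have := Finset.single_le_sum (f := fun i => if (z ∘ g) i ∈ A then 1 else 0)
        (fun _ _ => Nat.zero_le _) (Finset.mem_univ i)
      simp only [if_pos hi] at this
      omega
    obtain ⟨d, hd⟩ := exists_tailFunction_eq_mul hφ h hba hba' (Or.inl hmax)
    refine ⟨c * d, fun x => ?_⟩
    rw [fixTail_eq, tailFunction_smul, hd, Units.val_mul, mul_assoc]
  · rintro ⟨c, hc⟩
    refine ⟨fun x => c * φ x, ⟨c, fun _ => rfl⟩, a, hai, hba.right_mem,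
      indep_ofFunction.2 ⟨_, hba.ne_zero, ?_⟩, ?_⟩
    · intro e he
      obtain ⟨i, -, rfl⟩ := Finset.mem_image.1 he
      exact ⟨(finSum h).symm (Sum.inr i), by simp⟩
    · ext x
      rw [fixTail_eq, tailFunction_smul, hc]

theorem delete_ofFunction (hφ : IsGrassmannPlucker E r φ) (h : r = k + l) {b : Fin k → α}
    {a : Fin l → α} (hba : IsSplitBasis E A (fun x => φ (x ∘ finSum h)) b a)
    (hmin : ∀ z, φ z ≠ 0 → l ≤ entryCount A z) :
    (ofFunction E r φ).delete A =
      ofFunction (E \ A) k (tailFunction (E \ A) (fun x => φ (x ∘ finSum h)) a) := by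
  have ha := (isGrassmannPlucker_iff.1 hφ).1
  have hbA : ∀ i, b i ∉ A := fun i => (Finset.mem_sdiff.1 (hba.left_mem i)).2
  have hrk : (ofFunction E r φ).rk (E \ A) = k := by
    -- Every basis has r entries, so the minimal count in A corresponds to the maximal count in its
    -- complement, which is the rank there.
    have hsum : ∀ z, φ z ≠ 0 → entryCount (E \ A) z + entryCount A z = r := fun z hz => by
      rw [entryCount_sdiff_add A (ha.mem_of_ne_zero hz), Fintype.card_fin]
    have hc : entryCount (E \ A) (Sum.elim b a ∘ finSum h) = k := by
      have := hsum _ hba.ne_zero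
      rw [entryCount_comp A, entryCount_tail hbA hba.right_mem, Fintype.card_fin] at this
      omega
    rw [← hc]
    refine rk_eq ha hba.ne_zero fun w hw => ?_
    have h1 := hsum w hw
    have h2 := hmin w hw
    omega
  subst hrk
  obtain rfl : l = r - (ofFunction E r φ).rk (E \ A) := by omega
  suffices key : ∀ ψ : (Fin ((ofFunction E r φ).rk (E \ A)) → α) → F,
      (∃ φ' : (Fin r → α) → F, (∃ c : Fˣ, ∀ x, φ' x = c * φ x) ∧
        ∃ a : Fin (r - (ofFunction E r φ).rk (E \ A)) → α, (∀ i, a i ∈ A) ∧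
          (∃ b : Fin ((ofFunction E r φ).rk (E \ A)) → α, (∀ i, b i ∈ E \ A) ∧
            (ofFunction E r φ).IsBasisTuple (fun i => Fin.append b a (Fin.cast h i))) ∧
          ψ = fixTail (E \ A) h φ' a) ↔
      ∃ c : Fˣ, ∀ x, ψ x = c * tailFunction (E \ A) (fun x => φ (x ∘ finSum h)) a x from
    ofFunction_eq_of_reps key
  refine fun ψ => ⟨?_, ?_⟩
  · rintro ⟨φ', ⟨c, hc⟩, a', hA', ⟨b', hb', hz⟩, rfl⟩
    obtain rfl : φ' = fun x => (c : F) * φ x := funext hc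
    have hz : φ (fun i => Fin.append b' a' (Fin.cast h i)) ≠ 0 := isBasisTuple_ofFunction.1 hz
    rw [append_cast_eq] at hz
    obtain ⟨d, hd⟩ := exists_tailFunction_eq_mul hφ h hba ⟨hb', hA', hz⟩ (Or.inr hmin)
    refine ⟨c * d, fun x => ?_⟩
    rw [fixTail_eq, tailFunction_smul, hd, Units.val_mul, mul_assoc]
  · rintro ⟨c, hc⟩
    refine ⟨fun x => c * φ x, ⟨c, fun _ => rfl⟩, a, hba.right_mem, ⟨b, hba.left_mem, ?_⟩, ?_⟩
    · have hne : φ (fun i => Fin.append b a (Fin.cast h i)) ≠ 0 := by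
        rw [append_cast_eq]
        exact hba.ne_zero
      exact isBasisTuple_ofFunction.2 hne
    · ext x
      rw [fixTail_eq, tailFunction_smul, hc]

theorem exists_contract_eq (hφ : IsGrassmannPlucker E r φ) (A : Finset α) :
    ∃ (k l : ℕ) (h : r = k + l) (b : Fin k → α) (a : Fin l → α),
      IsSplitBasis E A (fun x => φ (x ∘ finSum h)) b a ∧
      (∀ z, φ z ≠ 0 → entryCount A z ≤ l) ∧ (ofFunction E r φ).contract A =
        ofFunction (E \ A) k (tailFunction (E \ A) (fun x => φ (x ∘ finSum h)) a) := by
  obtain ⟨ha, h0, he⟩ := isGrassmannPlucker_iff.1 hφ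
  obtain ⟨z, hz, hmax, -⟩ := exists_common_basis ha he h0 (Finset.disjoint_empty_right A)
  have h : r = r - entryCount A z + entryCount A z := by
    have := entryCount_le A z
    rw [Fintype.card_fin] at this
    omega
  obtain ⟨b, a, hba⟩ := exists_isSplitBasis ha h hz rfl
  exact ⟨_, _, h, b, a, hba, hmax, contract_ofFunction hφ h hba hmax⟩

theorem exists_delete_eq (hφ : IsGrassmannPlucker E r φ) (A : Finset α) :
    ∃ (k l : ℕ) (h : r = k + l) (b : Fin k → α) (a : Fin l → α),
      IsSplitBasis E A (fun x => φ (x ∘ finSum h)) b a ∧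
      (∀ z, φ z ≠ 0 → l ≤ entryCount A z) ∧ (ofFunction E r φ).delete A =
        ofFunction (E \ A) k (tailFunction (E \ A) (fun x => φ (x ∘ finSum h)) a) := by
  obtain ⟨ha, h0, he⟩ := isGrassmannPlucker_iff.1 hφ
  obtain ⟨z, hz, -, hmin⟩ := exists_common_basis ha he h0 (Finset.disjoint_empty_left A)
  have h : r = r - entryCount A z + entryCount A z := by
    have := entryCount_le A z
    rw [Fintype.card_fin] at this
    omega
  obtain ⟨b, a, hba⟩ := exists_isSplitBasis ha h hz rfl
  exact ⟨_, _, h, b, a, hba, hmin, delete_ofFunction hφ h hba hmin⟩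

theorem IsFMatroid.contract {M : FMatroidData F α} (hM : M.IsFMatroid) (A : Finset α) :
    (M.contract A).IsFMatroid := by
  obtain ⟨E, r, φ, hφ, rfl⟩ := hM.exists_eq
  obtain ⟨k, l, h, b, a, hba, hmax, hc⟩ := exists_contract_eq hφ A
  rw [hc]
  exact isFMatroid_ofFunction (isGrassmannPlucker_tailFunction hφ h hba (Or.inl hmax))

theorem IsFMatroid.delete {M : FMatroidData F α} (hM : M.IsFMatroid) (A : Finset α) :
    (M.delete A).IsFMatroid := by
  obtain ⟨E, r, φ, hφ, rfl⟩ := hM.exists_eq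
  obtain ⟨k, l, h, b, a, hba, hmin, hc⟩ := exists_delete_eq hφ A
  rw [hc]
  exact isFMatroid_ofFunction (isGrassmannPlucker_tailFunction hφ h hba (Or.inr hmin))

theorem IsQuotientOf.contract {M N : FMatroidData F α} (h : M.IsQuotientOf N) (hM : M.IsFMatroid)
    (hN : N.IsFMatroid) (hE : M.ground = N.ground) (A : Finset α) :
    (M.contract A).IsQuotientOf (N.contract A) := by
  obtain ⟨E, r, μ, hμ, rfl⟩ := hM.exists_eq
  obtain ⟨E', w, ν, hν, rfl⟩ := hN.exists_eq
  obtain rfl : E = E' := hE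
  have aμ := (isGrassmannPlucker_iff.1 hμ).1
  have aν := (isGrassmannPlucker_iff.1 hν).1
  rw [isQuotientOf_ofFunction_iff aμ aν] at h
  obtain ⟨k, l, hr, b, a, hba, hmax, hc⟩ := exists_contract_eq hμ A
  obtain ⟨k', l', hw, b', a', hba', hmax', hc'⟩ := exists_contract_eq hν A
  rw [hc, hc', isQuotientOf_ofFunction_iff ((aμ.reindex _).tailFunction _ _)
    ((aν.reindex _).tailFunction _ _)]
  refine (h.reindex (finSum hr) (finSum hw)).tailFunction hba.right_mem hba'.right_mem
    (fun i => (aμ.reindex _).mem_of_ne_zero hba.ne_zero (Sum.inr i))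
    (fun i => (aν.reindex _).mem_of_ne_zero hba'.ne_zero (Sum.inr i)) (Or.inl fun z hz => ?_)
  rw [Fintype.card_fin, ← entryCount_comp A z (finSum hr)]
  exact hmax _ hz

theorem IsQuotientOf.delete {M N : FMatroidData F α} (h : M.IsQuotientOf N) (hM : M.IsFMatroid)
    (hN : N.IsFMatroid) (hE : M.ground = N.ground) (A : Finset α) :
    (M.delete A).IsQuotientOf (N.delete A) := by
  obtain ⟨E, r, μ, hμ, rfl⟩ := hM.exists_eq
  obtain ⟨E', w, ν, hν, rfl⟩ := hN.exists_eq
  obtain rfl : E = E' := hE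
  have aμ := (isGrassmannPlucker_iff.1 hμ).1
  have aν := (isGrassmannPlucker_iff.1 hν).1
  rw [isQuotientOf_ofFunction_iff aμ aν] at h
  obtain ⟨k, l, hr, b, a, hba, hmin, hc⟩ := exists_delete_eq hμ A
  obtain ⟨k', l', hw, b', a', hba', hmin', hc'⟩ := exists_delete_eq hν A
  rw [hc, hc', isQuotientOf_ofFunction_iff ((aμ.reindex _).tailFunction _ _)
    ((aν.reindex _).tailFunction _ _)]
  refine (h.reindex (finSum hr) (finSum hw)).tailFunction hba.right_mem hba'.right_mem
    (fun i => (aμ.reindex _).mem_of_ne_zero hba.ne_zero (Sum.inr i))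
    (fun i => (aν.reindex _).mem_of_ne_zero hba'.ne_zero (Sum.inr i)) (Or.inr fun z hz => ?_)
  rw [Fintype.card_fin, ← entryCount_comp A z (finSum hw)]
  exact hmin' _ hz

end FMatroidData

/-! ### Contraction and deletion commute and are exchanged by duality -/

namespace FMatroidData

section Minors

variable {F α : Type*} [Tract F] [DecidableEq α] {E I J : Finset α} {r k l : ℕ}
  {φ : (Fin r → α) → F}

theorem contract_delete_ofFunction (hφ : IsGrassmannPlucker E r φ) (hIJ : Disjoint I J)
    {m n p q : ℕ} (h : r = n + p) (h' : n = m + q) {c : Fin m → α} {a : Fin p → α} {d : Fin q → α}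
    (hc : ∀ i, c i ∈ (E \ I) \ J) (ha : ∀ i, a i ∈ I) (hd : ∀ i, d i ∈ J)
    (h0 : φ (Sum.elim (Sum.elim c d ∘ finSum h') a ∘ finSum h) ≠ 0)
    (hmax : ∀ z, φ z ≠ 0 → entryCount I z ≤ p) (hmin : ∀ z, φ z ≠ 0 → q ≤ entryCount J z) :
    ((ofFunction E r φ).contract I).delete J = ofFunction ((E \ I) \ J) m
      (tailFunction ((E \ I) \ J) (fun y =>
        tailFunction (E \ I) (fun x => φ (x ∘ finSum h)) a (y ∘ finSum h')) d) := by
  have aφ := (isGrassmannPlucker_iff.1 hφ).1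
  have hb : IsSplitBasis E I (fun x => φ (x ∘ finSum h)) (Sum.elim c d ∘ finSum h') a := by
    refine ⟨fun i => ?_, ha, h0⟩
    refine Finset.mem_sdiff.2
      ⟨(aφ.reindex (finSum h)).mem_of_ne_zero h0 (Sum.inl i), ?_⟩
    rw [comp_apply]
    rcases finSum h' i with j | j
    · exact (Finset.mem_sdiff.1 (Finset.mem_sdiff.1 (hc j)).1).2
    · exact Finset.disjoint_right.1 hIJ (hd j)
  rw [contract_ofFunction hφ h hb hmax]
  refine delete_ofFunction (isGrassmannPlucker_tailFunction hφ h hb (Or.inl hmax)) h'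
    ⟨hc, hd, hb.tailFunction_ne_zero⟩ fun y hy => ?_
  have := hmin _ (ne_zero_of_tailFunction_ne_zero hy)
  rwa [entryCount_comp, entryCount_sum_elim,
    entryCount_of_forall_notMem fun i => Finset.disjoint_left.1 hIJ (ha i), add_zero] at this

theorem delete_contract_ofFunction (hφ : IsGrassmannPlucker E r φ) (hIJ : Disjoint I J)
    {m n p q : ℕ} (h : r = n + q) (h' : n = m + p) {c : Fin m → α} {a : Fin p → α} {d : Fin q → α}
    (hc : ∀ i, c i ∈ (E \ J) \ I) (ha : ∀ i, a i ∈ I) (hd : ∀ i, d i ∈ J)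
    (h0 : φ (Sum.elim (Sum.elim c a ∘ finSum h') d ∘ finSum h) ≠ 0)
    (hmax : ∀ z, φ z ≠ 0 → entryCount I z ≤ p) (hmin : ∀ z, φ z ≠ 0 → q ≤ entryCount J z) :
    ((ofFunction E r φ).delete J).contract I = ofFunction ((E \ J) \ I) m
      (tailFunction ((E \ J) \ I) (fun y =>
        tailFunction (E \ J) (fun x => φ (x ∘ finSum h)) d (y ∘ finSum h')) a) := by
  have aφ := (isGrassmannPlucker_iff.1 hφ).1
  have hb : IsSplitBasis E J (fun x => φ (x ∘ finSum h)) (Sum.elim c a ∘ finSum h') d := by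
    refine ⟨fun i => ?_, hd, h0⟩
    refine Finset.mem_sdiff.2
      ⟨(aφ.reindex (finSum h)).mem_of_ne_zero h0 (Sum.inl i), ?_⟩
    rw [comp_apply]
    rcases finSum h' i with j | j
    · exact (Finset.mem_sdiff.1 (Finset.mem_sdiff.1 (hc j)).1).2
    · exact Finset.disjoint_left.1 hIJ (ha j)
  rw [delete_ofFunction hφ h hb hmin]
  refine contract_ofFunction (isGrassmannPlucker_tailFunction hφ h hb (Or.inr hmin)) h'
    ⟨hc, ha, hb.tailFunction_ne_zero⟩ fun y hy => ?_
  have := hmax _ (ne_zero_of_tailFunction_ne_zero hy)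
  rwa [entryCount_comp, entryCount_sum_elim,
    entryCount_of_forall_notMem fun i => Finset.disjoint_right.1 hIJ (hd i), add_zero] at this

/-- Contractions and deletions of disjoint sets commute. -/
theorem IsFMatroid.delete_contract_comm {M : FMatroidData F α} (hM : M.IsFMatroid)
    (hIJ : Disjoint I J) : (M.delete J).contract I = (M.contract I).delete J := by
  obtain ⟨E, r, φ, hφ, rfl⟩ := hM.exists_eq
  obtain ⟨ha, h0, he⟩ := isGrassmannPlucker_iff.1 hφ
  obtain ⟨z, hz, hmax, hmin⟩ := exists_common_basis ha he h0 hIJ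
  obtain ⟨p, hp⟩ : ∃ p, entryCount I z = p := ⟨_, rfl⟩
  obtain ⟨q, hq⟩ : ∃ q, entryCount J z = q := ⟨_, rfl⟩
  rw [hp] at hmax
  rw [hq] at hmin
  obtain ⟨n, hn⟩ : ∃ n, r = n + p := ⟨r - p, by
    have := entryCount_le I z
    rw [Fintype.card_fin] at this
    omega⟩
  obtain ⟨e₁, hb, ha'⟩ := exists_equiv_sum (κ := Fin n) (l := Fin p) I z (by simp [hn])
    (by simpa using hp)
  have hzE : ∀ i, z i ∈ E := ha.mem_of_ne_zero hz
  have hqb : entryCount J (fun i => z (e₁ (Sum.inl i))) = q := by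
    rw [← hq, ← entryCount_comp J z e₁, ← Sum.elim_comp_inl_inr (z ∘ e₁), entryCount_sum_elim,
      entryCount_of_forall_notMem (z := (z ∘ e₁) ∘ Sum.inr)
        fun i => Finset.disjoint_left.1 hIJ (ha' i), add_zero]
    rfl
  obtain ⟨m, hm⟩ : ∃ m, n = m + q := ⟨n - q, by
    have := entryCount_le J (fun i => z (e₁ (Sum.inl i)))
    rw [Fintype.card_fin, hqb] at this
    omega⟩
  obtain ⟨e₂, hc, hd⟩ := exists_equiv_sum (κ := Fin m) (l := Fin q) J
    (fun i => z (e₁ (Sum.inl i))) (by simp [hm]) (by simpa using hqb)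
  let a : Fin p → α := fun i => z (e₁ (Sum.inr i))
  let c : Fin m → α := fun i => z (e₁ (Sum.inl (e₂ (Sum.inl i))))
  let d : Fin q → α := fun i => z (e₁ (Sum.inl (e₂ (Sum.inr i))))
  obtain ⟨n', hn'⟩ : ∃ n', r = n' + q := ⟨m + p, by omega⟩
  have hm' : n' = m + p := by omega
  let f₁ : Fin r ≃ (Fin m ⊕ Fin q) ⊕ Fin p :=
    (finSum hn).trans (Equiv.sumCongr (finSum hm) (Equiv.refl _))
  let g : (Fin m ⊕ Fin p) ⊕ Fin q ≃ (Fin m ⊕ Fin q) ⊕ Fin p :=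
    (Equiv.sumAssoc _ _ _).trans
      ((Equiv.sumCongr (Equiv.refl _) (Equiv.sumComm _ _)).trans (Equiv.sumAssoc _ _ _).symm)
  let f₂ : Fin r ≃ (Fin m ⊕ Fin q) ⊕ Fin p :=
    (finSum hn').trans ((Equiv.sumCongr (finSum hm') (Equiv.refl _)).trans g)
  have w₁ : ∀ x : Fin m → α, Sum.elim (Sum.elim x d ∘ finSum hm) a ∘ finSum hn =
      Sum.elim (Sum.elim x d) a ∘ f₁ := by
    intro x
    ext i
    simp only [f₁, comp_apply, Equiv.trans_apply]
    rcases finSum hn i with j | j <;> rfl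
  have w₂ : ∀ x : Fin m → α, Sum.elim (Sum.elim x a ∘ finSum hm') d ∘ finSum hn' =
      Sum.elim (Sum.elim x d) a ∘ f₂ := by
    intro x
    ext i
    simp only [f₂, comp_apply, Equiv.trans_apply]
    rcases finSum hn' i with j | j
    · simp only [Sum.elim_inl, comp_apply, Equiv.sumCongr_apply, Sum.map_inl]
      rcases finSum hm' j with j | j <;> rfl
    · rfl
  -- Both iterated minors fix the same entries d and a, in a different order; the resulting
  -- functions differ by the sign of one permutation, independent of x.
  have w : ∀ x : Fin m → α, φ (Sum.elim (Sum.elim x d) a ∘ f₂) =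
      ofSign F (Equiv.Perm.sign (f₂.trans f₁.symm)) * φ (Sum.elim (Sum.elim x d) a ∘ f₁) := by
    intro x
    rw [← ha.comp_perm]
    congr 1
    ext i
    simp
  have hz₁ : φ (Sum.elim (Sum.elim c d) a ∘ f₁) ≠ 0 := by
    have : Sum.elim (Sum.elim c d) a =
        z ∘ ((Equiv.sumCongr e₂ (Equiv.refl _)).trans e₁) := by
      ext i
      rcases i with (i | i) | i <;> rfl
    rw [this, comp_assoc]
    exact (ha.comp_perm_ne_zero (f₁.trans ((Equiv.sumCongr e₂ (Equiv.refl _)).trans e₁))).2 hz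
  have hcE : ∀ i, c i ∈ (E \ I) \ J := fun i =>
    Finset.mem_sdiff.2 ⟨Finset.mem_sdiff.2 ⟨hzE _, hb _⟩, hc i⟩
  rw [contract_delete_ofFunction hφ hIJ hn hm hcE ha' hd (by rwa [w₁]) hmax hmin,
    delete_contract_ofFunction (c := c) hφ hIJ hn' hm' (fun i => by
      rw [sdiff_right_comm]; exact hcE i) ha' hd
      (by rw [w₂, w]; exact mul_ne_zero (ofSign_ne_zero _) hz₁) hmax hmin,
    sdiff_right_comm E J I]
  refine ofFunction_congr
    (Units.mk0 _ (ofSign_ne_zero (Equiv.Perm.sign (f₂.trans f₁.symm)))) fun x => ?_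
  by_cases hx : ∀ i, x i ∈ (E \ I) \ J
  · have hxI : ∀ i, (Sum.elim x d ∘ finSum hm) i ∈ E \ I := by
      intro i
      rw [comp_apply]
      rcases finSum hm i with j | j
      · exact (Finset.mem_sdiff.1 (hx j)).1
      · exact Finset.mem_sdiff.2 ⟨hzE _, Finset.disjoint_right.1 hIJ (hd j)⟩
    have hxJ : ∀ i, (Sum.elim x a ∘ finSum hm') i ∈ E \ J := by
      intro i
      rw [comp_apply]
      rcases finSum hm' i with j | j
      · exact Finset.mem_sdiff.2 ⟨(Finset.mem_sdiff.1 (Finset.mem_sdiff.1 (hx j)).1).1,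
          (Finset.mem_sdiff.1 (hx j)).2⟩
      · exact Finset.mem_sdiff.2 ⟨hzE _, Finset.disjoint_left.1 hIJ (ha' j)⟩
    rw [tailFunction_apply hx, tailFunction_apply hx, tailFunction_apply hxI,
      tailFunction_apply hxJ]
    exact (congrArg φ (w₂ x)).trans ((w x).trans (congrArg _ (congrArg φ (w₁ x).symm)))
  · rw [tailFunction_of_not_forall_mem hx, tailFunction_of_not_forall_mem hx, mul_zero]

end Minors

section DualMinors

variable {F α : Type*} [Tract F] [LinearOrder α] {τ : TractHom F F}

/-- For a basis (b, a) with a maximal part a in A, let c and d be the complements of b in E \ A and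
of a in A. Then (c, d) is a basis of the dual with minimal part d in A, and fixing d in the dual
function is dual to fixing a, for the restricted orientation. -/
theorem IsFMatroid.dual_contract (hτ : τ.IsInvolution) {M : FMatroidData F α} (hM : M.IsFMatroid)
    {A : Finset α} (hA : A ⊆ M.ground) : (M.contract A).dual τ = (M.dual τ).delete A := by
  obtain ⟨E, r, φ, hφ, rfl⟩ := hM.exists_eq
  replace hA : A ⊆ E := hA
  obtain ⟨aφ, n0, eφ⟩ := isGrassmannPlucker_iff.1 hφ
  obtain ⟨k, l, h, b, a, hba, hmax, hc⟩ := exists_contract_eq hφ A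
  have hinj := (aφ.reindex (finSum h)).injective_of_ne_zero hba.ne_zero
  have hbi : Injective b := hinj.comp Sum.inl_injective
  have hai : Injective a := hinj.comp Sum.inr_injective
  have hk : k ≤ (E \ A).card := by
    simpa using Finset.card_le_card_of_injOn (s := Finset.univ) b (by simpa using hba.left_mem)
      hbi.injOn
  have hl : l ≤ A.card := by
    simpa using Finset.card_le_card_of_injOn (s := Finset.univ) a (by simpa using hba.right_mem)
      hai.injOn
  have hcard := Finset.card_sdiff_add_card_eq_card hA
  obtain ⟨k', hk'⟩ : ∃ k', k' + k = (E \ A).card := ⟨_, Nat.sub_add_cancel hk⟩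
  obtain ⟨l', hl'⟩ : ∃ l', l' + l = A.card := ⟨_, Nat.sub_add_cancel hl⟩
  obtain ⟨c, hcb⟩ := exists_isEnumeration_left (κ := Fin k') (by simpa using hk') hbi hba.left_mem
  obtain ⟨d, hda⟩ := exists_isEnumeration_left (κ := Fin l') (by simpa using hl') hai hba.right_mem
  obtain ⟨s, hs⟩ := exists_isOrientation F E ((Fin k' ⊕ Fin l') ⊕ (Fin k ⊕ Fin l))
  obtain ⟨ψ, hψ⟩ := exists_isDualWith τ hs (aφ.reindex (finSum h))
  have hcd : IsEnumeration E (Sum.elim (Sum.elim c d) (Sum.elim b a)) := by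
    have : Sum.elim (Sum.elim c b) (Sum.elim d a) ∘
        Equiv.sumSumSumComm (Fin k') (Fin l') (Fin k) (Fin l) =
        Sum.elim (Sum.elim c d) (Sum.elim b a) := by
      ext i
      rcases i with (i | i) | (i | i) <;> rfl
    rw [← this]
    exact (hcb.sum_elim hA hda).reindex _
  have hψ' := hψ.reindex (finSum (r := k' + l') rfl).symm (finSum h).symm
  have hφs : (fun x : Fin r → α => φ ((x ∘ (finSum h).symm) ∘ finSum h)) = φ := by
    ext x
    simp [comp_assoc]
  rw [hφs] at hψ'
  have hs' := hs.reindex (Equiv.sumCongr (finSum (r := k' + l') rfl).symm (finSum h).symm)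
  have hd : (ofFunction E r φ).dual τ =
      ofFunction E (k' + l') (fun x => ψ (x ∘ (finSum rfl).symm)) :=
    dual_ofFunction hτ (by omega) hs' hψ'
  have aψ : IsAlternating E fun x : Fin (k' + l') → α => ψ (x ∘ (finSum rfl).symm) :=
    hψ'.isAlternating hs' (by simp; omega)
  have gψ : IsGrassmannPlucker E (k' + l') fun x => ψ (x ∘ (finSum rfl).symm) := by
    refine isGrassmannPlucker_iff.2 ⟨aψ, ?_, ?_⟩
    · exact hψ'.exists_ne_zero hs' (by simp; omega) aφ n0
    · refine ((eφ.reindex (finSum h) (finSum h)).dual (aφ.reindex _) hs hs hψ hψ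
        (by simp; omega) (by simp; omega)).reindex _ _
  have hψs : (fun x : Fin k' ⊕ Fin l' → α => ψ ((x ∘ finSum rfl) ∘ (finSum rfl).symm)) = ψ := by
    ext x
    simp [comp_assoc]
  have hsplit : IsSplitBasis E A
      (fun x : Fin k' ⊕ Fin l' → α => ψ ((x ∘ finSum rfl) ∘ (finSum rfl).symm)) c d := by
    refine ⟨hcb.left_mem, hda.left_mem, (congrFun hψs _).trans_ne ?_⟩
    exact (hψ.apply_ne_zero_iff hs hcd).2 hba.ne_zero
  rw [hc, hd, delete_ofFunction gψ rfl hsplit, hψs]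
  · refine dual_ofFunction hτ hk' ?_ (hψ.tailFunction hA hda)
    exact (hs.reindex (Equiv.sumSumSumComm (Fin k') (Fin l') (Fin k) (Fin l))).restrict hA hda
  · intro y hy
    obtain ⟨y', hy'⟩ := exists_isEnumeration (ι := Fin r) (by simp; omega)
      (aψ.injective_of_ne_zero hy) (aψ.mem_of_ne_zero hy)
    -- Complementary tuples have A-counts with sum |A| = l' + l, so the upper bound l becomes the
    -- lower bound l'.
    have hc := entryCount_of_isEnumeration hA hy'
    have hne := (hψ'.apply_ne_zero_iff hs' hy').1 hy
    have := hmax y' hne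
    rw [entryCount_sum_elim] at hc
    omega

/-- This is the contraction case for the dual matroid, combined with biduality. -/
theorem IsFMatroid.dual_delete (hτ : τ.IsInvolution) {M : FMatroidData F α} (hM : M.IsFMatroid)
    {A : Finset α} (hA : A ⊆ M.ground) : (M.delete A).dual τ = (M.dual τ).contract A := by
  have hd := hM.dual hτ
  rw [← (hd.contract A).dual_dual hτ, hd.dual_contract hτ hA, hM.dual_dual hτ]

end DualMinors

end FMatroidData

/-! ### Flag F-matroids and the main theorem -/

theorem IsFlagMatroid.dual {F α : Type*} [Tract F] [LinearOrder α] {τ : TractHom F F}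
    (hτ : τ.IsInvolution) {E : Finset α} {s : ℕ} {M : Fin s → FMatroidData F α}
    (h : IsFlagMatroid E M) : IsFlagMatroid E (FlagMatroid.dual τ M) where
  isFMatroid _ := (h.isFMatroid _).dual hτ
  ground_eq _ := h.ground_eq _
  quotient i j hij := (h.quotient j.rev i.rev (Fin.rev_lt_rev.2 hij)).dual hτ (h.isFMatroid _)
    (h.isFMatroid _) ((h.ground_eq _).trans (h.ground_eq _).symm)

theorem IsFlagMatroid.minor {F α : Type*} [Tract F] [DecidableEq α] {E : Finset α} {s : ℕ}
    {M : Fin s → FMatroidData F α} (h : IsFlagMatroid E M) (I J : Finset α) :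
    IsFlagMatroid (E \ (I ∪ J)) (FlagMatroid.minor M I J) where
  isFMatroid i := ((h.isFMatroid i).delete I).contract J
  ground_eq i := by
    change ((M i).ground \ I) \ J = _
    rw [h.ground_eq, sdiff_sdiff_left]
    rfl
  quotient i j hij := by
    have hE : (M i).ground = (M j).ground := (h.ground_eq i).trans (h.ground_eq j).symm
    exact ((h.quotient i j hij).delete (h.isFMatroid i) (h.isFMatroid j) hE I).contract
      ((h.isFMatroid i).delete I) ((h.isFMatroid j).delete I) (congrArg (· \ I) hE) J

theorem IsFlagMatroid.dual_minor {F α : Type*} [Tract F] [LinearOrder α] {τ : TractHom F F}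
    (hτ : τ.IsInvolution) {E : Finset α} {s : ℕ} {M : Fin s → FMatroidData F α}
    (h : IsFlagMatroid E M) {I J : Finset α} (hI : I ⊆ E) (hJ : J ⊆ E) (hIJ : Disjoint I J) :
    FlagMatroid.dual τ (FlagMatroid.minor M I J) =
      FlagMatroid.minor (FlagMatroid.dual τ M) J I := by
  funext i
  have hM := h.isFMatroid i.rev
  have hE := h.ground_eq i.rev
  change (((M i.rev).delete I).contract J).dual τ = (((M i.rev).dual τ).delete J).contract I
  rw [(hM.delete I).dual_contract hτ, hM.dual_delete hτ (hE ▸ hI),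
    (hM.dual hτ).delete_contract_comm hIJ]
  change J ⊆ (M i.rev).ground \ I
  rw [hE]
  exact Finset.subset_sdiff.2 ⟨hJ, hIJ.symm⟩

/-- Repeated indices are harmless: the Plücker relations of a Grassmann–Plücker function say that
its matroid is a quotient of itself. -/
theorem IsFlagMatroid.comp_monotone {F α : Type*} [Tract F] {E : Finset α} {s t : ℕ}
    {M : Fin s → FMatroidData F α} (h : IsFlagMatroid E M) {i : Fin t → Fin s}
    (hi : Monotone i) : IsFlagMatroid E (fun k => M (i k)) where
  isFMatroid _ := h.isFMatroid _
  ground_eq _ := h.ground_eq _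
  quotient k k' hk := by
    rcases (hi hk.le).lt_or_eq with hlt | heq
    · exact h.quotient _ _ hlt
    · rw [← heq]
      obtain ⟨E', r, φ, hφ, hM⟩ := (h.isFMatroid (i k)).exists_eq
      obtain ⟨ha, -, he⟩ := isGrassmannPlucker_iff.1 hφ
      rw [hM]
      exact (FMatroidData.isQuotientOf_ofFunction_iff ha ha).2 he

theorem IsFlagMatroid.push {F F' α : Type*} [Tract F] [Tract F'] {E : Finset α} {s : ℕ}
    {M : Fin s → FMatroidData F α} (h : IsFlagMatroid E M) (f : TractHom F F') :
    IsFlagMatroid E (FlagMatroid.push f M) where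
  isFMatroid i := (h.isFMatroid i).push f
  ground_eq i := h.ground_eq i
  quotient i j hij := (h.quotient i j hij).push (h.isFMatroid i) (h.isFMatroid j)
    ((h.ground_eq i).trans (h.ground_eq j).symm) f

theorem IsFlagMatroid.dual_dual {F α : Type*} [Tract F] [LinearOrder α] {τ : TractHom F F}
    (hτ : τ.IsInvolution) {E : Finset α} {s : ℕ} {M : Fin s → FMatroidData F α}
    (h : IsFlagMatroid E M) : FlagMatroid.dual τ (FlagMatroid.dual τ M) = M := by
  funext i
  change ((M i.rev.rev).dual τ).dual τ = M i
  rw [Fin.rev_rev, (h.isFMatroid i).dual_dual hτ]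

theorem FlagMatroid.dual_mem_ofRank {F α : Type*} [Tract F] [LinearOrder α] {τ : TractHom F F}
    (hτ : τ.IsInvolution) {E : Finset α} {s : ℕ} {r : Fin s → ℕ} {M : Fin s → FMatroidData F α}
    (h : M ∈ FlagMatroid.ofRank F E r) :
    FlagMatroid.dual τ M ∈ FlagMatroid.ofRank F E (fun i => E.card - r i.rev) := by
  refine ⟨h.1.dual hτ, fun i => ?_⟩
  change (M i.rev).ground.card - (M i.rev).rank = _
  rw [h.1.ground_eq, h.2]

end

theorem theoremD {F F' α : Type*} [Tract F] [Tract F'] [LinearOrder α]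
    (τ : TractHom F F) (hτ : τ.IsInvolution) (E : Finset α) {s : ℕ} :
    (∀ M : Fin s → FMatroidData F α, IsFlagMatroid E M →
      IsFlagMatroid E (FlagMatroid.dual τ M) ∧
      (∀ I J : Finset α, I ⊆ E → J ⊆ E → Disjoint I J →
        IsFlagMatroid (E \ (I ∪ J)) (FlagMatroid.minor M I J) ∧
        FlagMatroid.dual τ (FlagMatroid.minor M I J) =
          FlagMatroid.minor (FlagMatroid.dual τ M) J I) ∧
      (∀ (t : ℕ) (i : Fin t → Fin s), Monotone i → IsFlagMatroid E (fun k => M (i k))) ∧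
      (∀ f : TractHom F F', IsFlagMatroid E (FlagMatroid.push f M))) ∧
    (∀ r : Fin s → ℕ, Monotone r → (∀ i, r i ≤ E.card) →
      Set.BijOn (FlagMatroid.dual τ) (FlagMatroid.ofRank F E r)
        (FlagMatroid.ofRank F E (fun i => E.card - r i.rev))) := by
  refine ⟨fun M hM => ⟨hM.dual hτ, fun I J hI hJ hIJ => ⟨hM.minor I J, hM.dual_minor hτ hI hJ hIJ⟩,
    fun t i hi => hM.comp_monotone hi, fun f => hM.push f⟩, fun r _ hr => ?_⟩
  refine Set.BijOn.mk (fun M hM => FlagMatroid.dual_mem_ofRank hτ hM) ?_ ?_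
  · intro M hM N hN hMN
    rw [← hM.1.dual_dual hτ, hMN, hN.1.dual_dual hτ]
  · intro N hN
    refine ⟨FlagMatroid.dual τ N, ?_, hN.1.dual_dual hτ⟩
    have h := FlagMatroid.dual_mem_ofRank hτ hN
    -- Reversing twice and n - (n - r_i) = r_i, valid for truncated subtraction since r_i ≤ n,
    -- return the original ranks.
    simpa only [Fin.rev_rev, Nat.sub_sub_self (hr _)] using h
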